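/- Let $S$ be a quantum system with finite-dimensional state space $\mathcal H_S\neq 0$, coupled to an environment $E$ with finite-dimensional state space $\mathcal H_E$, with drift Hamiltonian $$H_0(t)=H_S(t)\otimes I_E+I_S\otimes H_E+\sum_a J_a(t)\otimes B_a$$ (a finite sum), where $H_S(t)$, $H_E$ and $\sum_a J_a(t)\otimes B_a$ are Hermitian, $H_S(t)$ and all $J_a(t)$ are traceless, and $H_S$, $J_a$ are measurable functions of $t$. Let $\mathcal G$ be a finite group acting on $\mathcal H_S$ by unitary operators through a projective representation. Let the control propagator $U_c(t)$, $t\ge 0$, be a random bang-bang path over $\mathcal G$: for each $t$, $U_c(t)$ is the operator of a random element of $\mathcal G$, and the paths in $\mathcal G$ are right-continuous and piecewise constant, with finitely many jumps in each bounded time interval. Let $\tilde U(t)$ be the propagator in the logical frame, i.e. the solution of $$\tilde U(t)=I-i\int_0^t \tilde H(s)\tilde U(s)\,ds,\qquad \tilde H(t)=(U_c(t)\otimes I_E)^\dagger H_0(t)\,(U_c(t)\otimes I_E).$$ For a fixed initial density operator $\rho_E$ of the environment and a pure state $\pi=|\psi\rangle\langle\psi|$ of $S$, let $$\epsilon_T(\pi)=\mathbf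 E\,\mathrm{tr}_S\big((I_S-\pi)\,\mathrm{tr}_E[\tilde U(T)(\pi\otimes\rho_E)\tilde U(T)^\dagger]\big),\qquad \epsilon_T=\max_{\pi}\epsilon_T(\pi).$$ Let $\Delta t>0$ and $k$ be real, and assume: (i) $\mathcal G$ acts irreducibly on $\mathcal H_S$; (ii) for each $t\ge0$, the group element applied at time $t$ is uniformly distributed over $\mathcal G$; (iii) for each $t>0$, the group element applied at time $t$ is independent of the family of the group elements applied at all times $s>0$ with $|s-t|>\Delta t$; (iv) $\big\|H_S(t)\otimes I_E+\sum_a J_a(t)\otimes B_a\big\|\le k$ for all $t\ge0$, in operator norm. Then $\tilde U$ exists for every sample path, the expectations and the maximum above exist, and for every $T>0$ with $4T\Delta t\,k^2<1$, $$\epsilon_T\le 4T\Delta t\,k^2\,\frac{1+8\Delta t\,k+4T\Delta t\,k^2}{(1-4T\Delta t\,k^2)^2}.$$ Moreover $\epsilon_T=O(T\Delta t\,k^2)$ for $T\Delta t\,k^2\ll1$: there are universal constants $C,\delta>0$ (the same for all such systems, environments, groups, controls, and all $T,\Delta t,k$) such that $\epsilon_T\le C\,T\Delta t\,k^2$ whenever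 $T>0$ and $T\Delta t\,k^2\le\delta$. -/

import Mathlib

open MeasureTheory ProbabilityTheory Filter Topology
open scoped Matrix Kronecker ComplexOrder Matrix.Norms.L2Operator

/-- A finite decoupling group acting on `ℂ^S` by unitary operators, through a projective
representation (a group homomorphism up to phase factors). -/
structure DecouplingGroup (G S : Type*) [Group G] [Fintype S] [DecidableEq S] where
  /-- the unitary operator of a group element -/
  op : G → Matrix.unitaryGroup S ℂ
  map_one : op 1 = 1
  map_mul : ∀ g h : G, ∃ c : ℂ,
    (op (g * h) : Matrix S S ℂ) = c • ((op g : Matrix S S ℂ) * (op h : Matrix S S ℂ))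

/-- Irreducibility: there is no invariant subspace except `0` and the whole space. -/
def DecouplingGroup.Irreducible {G S : Type*} [Group G] [Fintype S] [DecidableEq S]
    (R : DecouplingGroup G S) : Prop :=
  ∀ W : Submodule ℂ (S → ℂ),
    (∀ g : G, ∀ v ∈ W, (R.op g : Matrix S S ℂ) *ᵥ v ∈ W) → W = ⊥ ∨ W = ⊤

/-- The drift Hamiltonian `H₀(t) = H_S(t) ⊗ I + I ⊗ H_E + ∑ₐ Jₐ(t) ⊗ Bₐ` of an open system `S`
coupled to an environment `E`, with traceless `H_S(t)` and `Jₐ(t)`. The time dependence is only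
required to be measurable. The individual `Jₐ(t)`, `Bₐ` need not be Hermitian, but the coupling
`∑ₐ Jₐ(t) ⊗ Bₐ` is. -/
structure OpenSystem (S E A : Type*) [Fintype S] [DecidableEq S] [Fintype E] [DecidableEq E]
    [Fintype A] where
  HS : ℝ → Matrix S S ℂ
  HE : Matrix E E ℂ
  J : A → ℝ → Matrix S S ℂ
  B : A → Matrix E E ℂ
  HS_hermitian : ∀ t, (HS t).IsHermitian
  HE_hermitian : HE.IsHermitian
  coupling_hermitian : ∀ t, (∑ a, J a t ⊗ₖ B a).IsHermitian
  HS_trace : ∀ t, (HS t).trace = 0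
  J_trace : ∀ a t, (J a t).trace = 0
  HS_measurable : ∀ i j, Measurable fun t => HS t i j
  J_measurable : ∀ a i j, Measurable fun t => J a t i j

section OpenSystem

variable {S E A : Type*} [Fintype S] [DecidableEq S] [Fintype E] [DecidableEq E] [Fintype A]

/-- The total interaction Hamiltonian `H_S(t) ⊗ I + ∑ₐ Jₐ(t) ⊗ Bₐ`. -/
def OpenSystem.interaction (D : OpenSystem S E A) (t : ℝ) : Matrix (S × E) (S × E) ℂ :=
  D.HS t ⊗ₖ (1 : Matrix E E ℂ) + ∑ a, D.J a t ⊗ₖ D.B a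

/-- The drift Hamiltonian `H₀(t)`. -/
def OpenSystem.drift (D : OpenSystem S E A) (t : ℝ) : Matrix (S × E) (S × E) ℂ :=
  D.HS t ⊗ₖ (1 : Matrix E E ℂ) + (1 : Matrix S S ℂ) ⊗ₖ D.HE + ∑ a, D.J a t ⊗ₖ D.B a

/-- The logical-frame Hamiltonian `H̃(t) = (U_c(t) ⊗ I)† H₀(t) (U_c(t) ⊗ I)` for a control
propagator `U_c` acting on `S` only. -/
def OpenSystem.logicalHamiltonian (D : OpenSystem S E A) (Uc : ℝ → Matrix.unitaryGroup S ℂ)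
    (t : ℝ) : Matrix (S × E) (S × E) ℂ :=
  ((Uc t : Matrix S S ℂ) ⊗ₖ (1 : Matrix E E ℂ))ᴴ * D.drift t *
    ((Uc t : Matrix S S ℂ) ⊗ₖ (1 : Matrix E E ℂ))

end OpenSystem

/-- `U` is the propagator of the time-dependent Hamiltonian `H` on `[0, ∞)`: `U(0) = 1` and
`dU/dt = -i H(t) U(t)`, in integrated form (as `H` may jump). -/
def IsPropagator {N : Type*} [Fintype N] [DecidableEq N] (H U : ℝ → Matrix N N ℂ) : Prop :=
  ContinuousOn U (Set.Ici 0) ∧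
    ∀ t : ℝ, 0 ≤ t → U t = 1 + ∫ s in (0 : ℝ)..t, (-Complex.I) • (H s * U s)

/-- A random bang-bang control path over `G`: a family of `G`-valued random variables indexed by
time `t ≥ 0`, all of whose paths are piecewise constant (constant just after each time, and just
before each positive time, hence with finitely many jumps in each bounded interval). -/
structure BangBangControl (Ω G : Type*) [MeasurableSpace Ω] [MeasurableSpace G] where
  path : ℝ → Ω → G
  measurable : ∀ t : ℝ, 0 ≤ t → Measurable (path t)
  const_right : ∀ ω, ∀ t : ℝ, 0 ≤ t → ∀ᶠ s in 𝓝[>] t, path s ω = path t ω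
  const_left : ∀ ω, ∀ t : ℝ, 0 < t → ∃ g : G, ∀ᶠ s in 𝓝[<] t, path s ω = g

section BangBangControl

variable {Ω G : Type*} [MeasurableSpace Ω] [MeasurableSpace G]

/-- Uniformity: at each time the control is uniformly distributed over the finite group `G`. -/
def BangBangControl.Uniform [Fintype G] (γ : BangBangControl Ω G) (P : Measure Ω) : Prop :=
  ∀ t : ℝ, 0 ≤ t → ∀ g : G, P.real {ω | γ.path t ω = g} = 1 / (Fintype.card G : ℝ)

/-- Independence beyond the time `Δt`: the control at time `t` is independent of the (joint)
values of the control at all the times that are further than `Δt` away from `t`. -/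
def BangBangControl.IndependentBeyond (γ : BangBangControl Ω G) (P : Measure Ω) (Δt : ℝ) : Prop :=
  ∀ t : ℝ, 0 < t →
    IndepFun (γ.path t) (fun ω (s : {s : ℝ // 0 < s ∧ Δt < |s - t|}) => γ.path s ω) P

/-- The control propagator `U_c(t)` along the sample path `ω`. -/
def BangBangControl.propagator {S : Type*} [Fintype S] [DecidableEq S] [Group G]
    (γ : BangBangControl Ω G) (R : DecouplingGroup G S) (ω : Ω) (t : ℝ) :
    Matrix.unitaryGroup S ℂ :=
  R.op (γ.path t ω)

end BangBangControl

noncomputable section ErrorProbability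

variable {S E : Type*} [Fintype S] [DecidableEq S] [Fintype E] [DecidableEq E]

/-- The projector `|ψ⟩⟨ψ|`. -/
def pureState (ψ : EuclideanSpace ℂ S) : Matrix S S ℂ :=
  Matrix.vecMulVec (fun i => ψ i) (fun i => star (ψ i))

/-- The partial trace over the environment. -/
def partialTraceEnv (ρ : Matrix (S × E) (S × E) ℂ) : Matrix S S ℂ :=
  Matrix.of fun i j => ∑ e, ρ (i, e) (j, e)

/-- The probability `tr_S (π⊥ tr_E (V (π ⊗ ρ_E) V†))`, with `π = |ψ⟩⟨ψ|` and `π⊥ = I - π`, that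
the joint evolution `V` takes the state `ψ` of `S` to an orthogonal state. -/
def escapeProbability (ρE : Matrix E E ℂ) (V : Matrix (S × E) (S × E) ℂ)
    (ψ : EuclideanSpace ℂ S) : ℝ :=
  ((1 - pureState ψ) * partialTraceEnv (V * (pureState ψ ⊗ₖ ρE) * Vᴴ)).trace.re

/-- The a priori error probability `ε_T(ψ)` for the random logical propagator `V`, at a fixed
final time: the expectation of `tr_S (π⊥ ρ̃_S)`. -/
def errorProbability {Ω : Type*} [MeasurableSpace Ω] (P : Measure Ω) (ρE : Matrix E E ℂ)
    (V : Ω → Matrix (S × E) (S × E) ℂ) (ψ : EuclideanSpace ℂ S) : ℝ :=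
  ∫ ω, escapeProbability ρE (V ω) ψ ∂P

/-- The worst-case pure-state error probability `ε_T`, over all unit vectors `ψ`. -/
def worstCaseError {Ω : Type*} [MeasurableSpace Ω] (P : Measure Ω) (ρE : Matrix E E ℂ)
    (V : Ω → Matrix (S × E) (S × E) ℂ) : ℝ :=
  sSup (errorProbability P ρE V '' {ψ : EuclideanSpace ℂ S | ‖ψ‖ = 1})

end ErrorProbability

/-! In the Heisenberg picture the escape probability is `τ(U† Q U)` with `Q = π⊥ ⊗ I` and `τ = tr((π
⊗ ρ_E) ·)`, and it starts from `τ(Q) = 0`. Since `Q` commutes with `I ⊗ H_E`, the interaction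
picture with respect to `I ⊗ H_E` removes that term without changing the escape probability. What
remains is a switched Hamiltonian `κ (γ t) t` of norm at most `k`, whose sum over the group vanishes
by Schur's lemma (`DecouplingGroup.Irreducible.sum_conj_eq_zero`,
`OpenSystem.sum_toggledInteraction`).

The derivative of the escape probability is `τ(i V†[K, Q]V)`, with `K` and `V` taken at time `t`. If
`V(t)` is replaced by `V(t')`, `t' = max (t - Δt) 0`, the propagator depends only on control values
independent of the uniform `γ t`, so averaging over `γ t` gives zero
(`integral_heisenbergRate_eq_zero`). The replacement costs at most `4k ‖V(t) - V(t')‖ ≤ 4k · kΔt`.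
Integration over `[0, T]` gives `ε_T ≤ 4TΔt k²` (`worstCaseError_le`), without any smallness
assumption; both bounds of the theorem are weaker.

The rest is analysis: Hamiltonians are only measurable in time, so the equations of motion hold
almost everywhere, and independence requires the propagator to be measurable with respect to the
past of the control. A Picard series gives this measurability, and uniqueness transfers it to any
given propagator. -/

/-- `u` is a primitive on `[0, T]` of the bounded integrable function `v`. -/
structure IsPrimitiveOn {F : Type*} [NormedAddCommGroup F] [NormedSpace ℝ F]
    (u v : ℝ → F) (T : ℝ) : Prop where
  nonneg : 0 ≤ T
  intervalIntegrable : IntervalIntegrable v volume 0 T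
  bounded : ∃ C, ∀ t ∈ Set.Icc 0 T, ‖v t‖ ≤ C
  eq_add : ∀ t ∈ Set.Icc 0 T, u t = u 0 + ∫ s in (0 : ℝ)..t, v s

/-! ### Calculus for primitives of bounded integrable functions. -/

namespace IsPrimitiveOn

section Module

variable {F F' : Type*} [NormedAddCommGroup F] [NormedSpace ℝ F]
  [NormedAddCommGroup F'] [NormedSpace ℝ F'] {u v : ℝ → F} {T : ℝ}

theorem intervalIntegrable_of_mem (h : IsPrimitiveOn u v T) {s t : ℝ} (hs : s ∈ Set.Icc 0 T)
    (ht : t ∈ Set.Icc 0 T) : IntervalIntegrable v volume s t := by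
  refine h.intervalIntegrable.mono_set ?_
  rw [Set.uIcc_of_le h.nonneg]
  exact Set.uIcc_subset_Icc hs ht

theorem sub_eq (h : IsPrimitiveOn u v T) {s t : ℝ} (hs : s ∈ Set.Icc 0 T)
    (ht : t ∈ Set.Icc 0 T) : u t - u s = ∫ r in s..t, v r := by
  have h0 : (0 : ℝ) ∈ Set.Icc 0 T := ⟨le_rfl, h.nonneg⟩
  rw [h.eq_add t ht, h.eq_add s hs, add_sub_add_left_eq_sub,
    intervalIntegral.integral_interval_sub_left (h.intervalIntegrable_of_mem h0 ht)
      (h.intervalIntegrable_of_mem h0 hs)]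

theorem norm_sub_le (h : IsPrimitiveOn u v T) {C : ℝ} (hC : ∀ t ∈ Set.Icc 0 T, ‖v t‖ ≤ C)
    {s t : ℝ} (hs : s ∈ Set.Icc 0 T) (ht : t ∈ Set.Icc 0 T) : ‖u t - u s‖ ≤ C * |t - s| := by
  rw [h.sub_eq hs ht]
  refine intervalIntegral.norm_integral_le_of_norm_le_const fun r hr => hC r ?_
  exact Set.uIcc_subset_Icc hs ht (Set.uIoc_subset_uIcc hr)

theorem exists_lipschitzOnWith (h : IsPrimitiveOn u v T) :
    ∃ C, LipschitzOnWith C u (Set.Icc 0 T) := by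
  obtain ⟨C, hC⟩ := h.bounded
  refine ⟨Real.toNNReal C, LipschitzOnWith.of_dist_le_mul fun x hx y hy => ?_⟩
  rw [dist_eq_norm, Real.dist_eq]
  refine (h.norm_sub_le hC hy hx).trans ?_
  gcongr
  exact Real.le_coe_toNNReal C

theorem continuousOn (h : IsPrimitiveOn u v T) : ContinuousOn u (Set.Icc 0 T) := by
  obtain ⟨C, hC⟩ := h.exists_lipschitzOnWith
  exact hC.continuousOn

theorem exists_bound (h : IsPrimitiveOn u v T) : ∃ C, ∀ t ∈ Set.Icc 0 T, ‖u t‖ ≤ C :=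
  isCompact_Icc.exists_bound_of_continuousOn h.continuousOn

theorem ae_hasDerivAt [CompleteSpace F] (h : IsPrimitiveOn u v T) :
    ∀ᵐ x, x ∈ Set.Ioo 0 T → HasDerivAt u (v x) x := by
  filter_upwards [h.intervalIntegrable.ae_hasDerivAt_integral] with x hx hxT
  have h1 := hx (by rw [Set.uIcc_of_le h.nonneg]; exact Set.Ioo_subset_Icc_self hxT) 0
    Set.left_mem_uIcc
  refine (h1.const_add (u 0)).congr_of_eventuallyEq ?_
  filter_upwards [Ioo_mem_nhds hxT.1 hxT.2] with y hy
  exact h.eq_add y (Set.Ioo_subset_Icc_self hy)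

/-- The difference between `u` and the integral of `v` is Lipschitz, hence absolutely continuous,
and its derivative vanishes almost everywhere, so it is constant. This allows differentiation rules
to be applied pointwise almost everywhere. -/
theorem of_lipschitzOnWith [CompleteSpace F] (hT : 0 ≤ T) {C : NNReal}
    (hu : LipschitzOnWith C u (Set.Icc 0 T))
    (hd : ∀ᵐ x, x ∈ Set.Ioo 0 T → HasDerivAt u (v x) x) (hv : IntervalIntegrable v volume 0 T)
    (hb : ∃ C, ∀ t ∈ Set.Icc 0 T, ‖v t‖ ≤ C) : IsPrimitiveOn u v T := by
  have hw : IsPrimitiveOn (fun t => ∫ s in (0 : ℝ)..t, v s) v T :=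
    ⟨hT, hv, hb, fun t _ => by simp⟩
  obtain ⟨C', hC'⟩ := hw.exists_lipschitzOnWith
  refine ⟨hT, hv, hb, fun t ht => ?_⟩
  have hlip := hu.sub hC'
  rw [← Set.uIcc_of_le hT] at hlip
  obtain ⟨c, hc⟩ := hlip.absolutelyContinuousOnInterval.const_of_ae_hasDerivAt_zero (by
    have h₁ : ∀ᵐ x : ℝ, x ≠ 0 := by simp [ae_iff, measure_singleton]
    have h₂ : ∀ᵐ x : ℝ, x ≠ T := by simp [ae_iff, measure_singleton]
    filter_upwards [hd, hw.ae_hasDerivAt, h₁, h₂] with x hx hx' hx0 hxT hxm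
    rw [Set.uIcc_of_le hT] at hxm
    have hxo : x ∈ Set.Ioo 0 T := ⟨lt_of_le_of_ne hxm.1 hx0.symm, lt_of_le_of_ne hxm.2 hxT⟩
    have hsub := (hx hxo).sub (hx' hxo)
    rwa [sub_self] at hsub)
  rw [Set.uIcc_of_le hT] at hc
  have h0 := hc 0 ⟨le_rfl, hT⟩
  have ht := hc t ht
  simp only [intervalIntegral.integral_same, sub_zero] at h0 ht
  rw [h0, ← ht]
  abel

theorem mono (h : IsPrimitiveOn u v T) {t : ℝ} (ht : t ∈ Set.Icc 0 T) : IsPrimitiveOn u v t :=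
  ⟨ht.1, h.intervalIntegrable_of_mem ⟨le_rfl, h.nonneg⟩ ht,
    h.bounded.imp fun _ hC s hs => hC s ⟨hs.1, hs.2.trans ht.2⟩,
    fun s hs => h.eq_add s ⟨hs.1, hs.2.trans ht.2⟩⟩

theorem congr (h : IsPrimitiveOn u v T) {v' : ℝ → F} (hv : ∀ t ∈ Set.Ioo 0 T, v t = v' t)
    (hb : ∃ C, ∀ t ∈ Set.Icc 0 T, ‖v' t‖ ≤ C) : IsPrimitiveOn u v' T := by
  have key : ∀ t ∈ Set.Icc 0 T, ∀ᵐ x, x ∈ Set.uIoc 0 t → v x = v' x := by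
    intro t ht
    have h₂ : ∀ᵐ x : ℝ, x ≠ T := by simp [ae_iff, measure_singleton]
    filter_upwards [h₂] with x hxT hx
    rw [Set.uIoc_of_le ht.1] at hx
    exact hv x ⟨hx.1, lt_of_le_of_ne (hx.2.trans ht.2) hxT⟩
  refine ⟨h.nonneg, h.intervalIntegrable.congr_ae ?_, hb, fun t ht => ?_⟩
  · exact (ae_restrict_iff' measurableSet_uIoc).2 (key T ⟨h.nonneg, le_rfl⟩)
  · rw [h.eq_add t ht, intervalIntegral.integral_congr_ae (key t ht)]

theorem map [CompleteSpace F] [CompleteSpace F'] (h : IsPrimitiveOn u v T) (L : F →L[ℝ] F') :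
    IsPrimitiveOn (fun t => L (u t)) (fun t => L (v t)) T := by
  obtain ⟨C, hC⟩ := h.bounded
  refine ⟨h.nonneg, ⟨L.integrable_comp h.intervalIntegrable.1,
    L.integrable_comp h.intervalIntegrable.2⟩, ⟨‖L‖ * C, fun t ht => ?_⟩, fun t ht => ?_⟩
  · exact (L.le_opNorm _).trans (by gcongr; exact hC t ht)
  · rw [h.eq_add t ht, map_add, L.intervalIntegral_comp_comm
      (h.intervalIntegrable_of_mem ⟨le_rfl, h.nonneg⟩ ht)]

theorem of_hasDerivAt [CompleteSpace F] (hT : 0 ≤ T) (h : ∀ t, HasDerivAt u (v t) t)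
    (hv : Continuous v) : IsPrimitiveOn u v T := by
  refine ⟨hT, hv.intervalIntegrable _ _,
    isCompact_Icc.exists_bound_of_continuousOn hv.continuousOn, fun t _ => ?_⟩
  rw [intervalIntegral.integral_eq_sub_of_hasDerivAt (fun x _ => h x)
    (hv.intervalIntegrable _ _)]
  abel

end Module

section Algebra

variable {A : Type*} [NormedRing A] [NormedAlgebra ℝ A] [CompleteSpace A]
  {u v w z : ℝ → A} {T : ℝ}

/-- The Leibniz rule holds only almost everywhere; it integrates because a product of bounded
Lipschitz functions is Lipschitz. -/
theorem mul (h : IsPrimitiveOn u v T) (h' : IsPrimitiveOn w z T) :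
    IsPrimitiveOn (fun t => u t * w t) (fun t => v t * w t + u t * z t) T := by
  obtain ⟨a, ha⟩ := h.exists_lipschitzOnWith
  obtain ⟨b, hb⟩ := h'.exists_lipschitzOnWith
  obtain ⟨c, hc⟩ := h.exists_bound
  obtain ⟨d, hd⟩ := h'.exists_bound
  obtain ⟨p, hp⟩ := h.bounded
  obtain ⟨q, hq⟩ := h'.bounded
  have hT := h.nonneg
  have h0 : (0 : ℝ) ∈ Set.Icc 0 T := ⟨le_rfl, hT⟩
  have hc0 : 0 ≤ c := (norm_nonneg _).trans (hc 0 h0)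
  have hd0 : 0 ≤ d := (norm_nonneg _).trans (hd 0 h0)
  have hp0 : 0 ≤ p := (norm_nonneg _).trans (hp 0 h0)
  refine of_lipschitzOnWith hT (C := a * d.toNNReal + c.toNNReal * b)
    (LipschitzOnWith.of_dist_le_mul fun x hx y hy => ?_) ?_ ?_ ?_
  · rw [dist_eq_norm]
    have e : u x * w x - u y * w y = (u x - u y) * w x + u y * (w x - w y) := by noncomm_ring
    have h1 := ha.dist_le_mul x hx y hy
    have h2 := hb.dist_le_mul x hx y hy
    rw [dist_eq_norm] at h1 h2
    rw [e]
    push_cast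
    rw [Real.coe_toNNReal d hd0, Real.coe_toNNReal c hc0]
    calc _ ≤ ‖u x - u y‖ * ‖w x‖ + ‖u y‖ * ‖w x - w y‖ :=
          (norm_add_le _ _).trans (add_le_add (norm_mul_le _ _) (norm_mul_le _ _))
      _ ≤ (a * dist x y) * d + c * (b * dist x y) := by
          gcongr
          · exact hd x hx
          · exact hc y hy
      _ = _ := by ring
  · filter_upwards [h.ae_hasDerivAt, h'.ae_hasDerivAt] with x hx hx' hxT
    exact (hx hxT).mul (hx' hxT)
  · have hcu : ContinuousOn u (Set.uIcc 0 T) := by rw [Set.uIcc_of_le hT]; exact h.continuousOn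
    have hcw : ContinuousOn w (Set.uIcc 0 T) := by rw [Set.uIcc_of_le hT]; exact h'.continuousOn
    exact (h.intervalIntegrable.mul_continuousOn hcw).add
      (h'.intervalIntegrable.continuousOn_mul hcu)
  · refine ⟨p * d + c * q, fun t ht => (norm_add_le _ _).trans ?_⟩
    refine add_le_add ((norm_mul_le _ _).trans ?_) ((norm_mul_le _ _).trans ?_)
    · exact mul_le_mul (hp t ht) (hd t ht) (norm_nonneg _) hp0
    · exact mul_le_mul (hc t ht) (hq t ht) (norm_nonneg _) hc0

end Algebra

end IsPrimitiveOn

/-! ### Propagators in a C*-algebra: isometry, uniqueness, Heisenberg equation. -/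

section Propagator

variable {A : Type*} [CStarAlgebra A]

/-- `U` is the propagator of the Hamiltonian `H`, bounded along `U`, on the time interval
`[0, T]`. -/
structure IsPropagatorOn (H U : ℝ → A) (T : ℝ) : Prop where
  zero : U 0 = 1
  isPrimitiveOn : IsPrimitiveOn U (fun s => (-Complex.I) • (H s * U s)) T

namespace IsPropagatorOn

variable {H H' U U' : ℝ → A} {T : ℝ}

theorem mono (h : IsPropagatorOn H U T) {t : ℝ} (ht : t ∈ Set.Icc 0 T) :
    IsPropagatorOn H U t :=
  ⟨h.zero, h.isPrimitiveOn.mono ht⟩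

theorem star_primitive (h : IsPropagatorOn H U T) (hH : ∀ t, IsSelfAdjoint (H t)) :
    IsPrimitiveOn (fun t => star (U t)) (fun t => Complex.I • (star (U t) * H t)) T := by
  have := h.isPrimitiveOn.map (starL' ℝ : A ≃L[ℝ] A).toContinuousLinearMap
  simpa [star_smul, (hH _).star_eq] using this

/-- The two terms of the derivative of `U† U'` cancel. The case `U' = U` gives `‖U‖ ≤ 1`, the
general case uniqueness. -/
theorem star_mul_eq_one (h : IsPropagatorOn H U T) (h' : IsPropagatorOn H' U' T)
    (hH : ∀ t, IsSelfAdjoint (H t)) (hHH : ∀ t ∈ Set.Ioo 0 T, H t = H' t) :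
    ∀ t ∈ Set.Icc 0 T, star (U t) * U' t = 1 := by
  intro t ht
  have := ((h.star_primitive hH).mul h'.isPrimitiveOn).congr (v' := fun _ => 0)
    (fun s hs => by simp [hHH s hs, mul_assoc]) ⟨0, by simp⟩
  simpa [h.zero, h'.zero] using this.eq_add t ht

theorem eq_of_eqOn [IsDedekindFiniteMonoid A] (h : IsPropagatorOn H U T)
    (h' : IsPropagatorOn H' U' T) (hH : ∀ t, IsSelfAdjoint (H t))
    (hHH : ∀ t ∈ Set.Ioo 0 T, H t = H' t) : ∀ t ∈ Set.Icc 0 T, U t = U' t := by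
  intro t ht
  -- Dedekind finiteness turns the isometry into a unitary, whence `U = U (U† U') = (U U†) U' = U'`.
  have h1 := mul_eq_one_comm.1 (h.star_mul_eq_one h hH (fun _ _ => rfl) t ht)
  rw [← mul_one (U t), ← h.star_mul_eq_one h' hH hHH t ht, ← mul_assoc, h1, one_mul]

theorem norm_le_one (h : IsPropagatorOn H U T) (hH : ∀ t, IsSelfAdjoint (H t)) {t : ℝ}
    (ht : t ∈ Set.Icc 0 T) : ‖U t‖ ≤ 1 := by
  have h1 := h.star_mul_eq_one h hH (fun _ _ => rfl) t ht
  have h2 := CStarRing.norm_star_mul_self (x := U t)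
  rw [h1] at h2
  rcases subsingleton_or_nontrivial A with hA | hA
  · simp [Subsingleton.elim (U t) 0]
  · rw [CStarRing.norm_one] at h2
    nlinarith [norm_nonneg (U t)]

theorem norm_sub_le (h : IsPropagatorOn H U T) (hH : ∀ t, IsSelfAdjoint (H t)) {k : ℝ}
    (hk : ∀ t, ‖H t‖ ≤ k) {s t : ℝ} (hs : s ∈ Set.Icc 0 T) (ht : t ∈ Set.Icc 0 T) :
    ‖U t - U s‖ ≤ k * |t - s| := by
  refine h.isPrimitiveOn.norm_sub_le (fun r hr => ?_) hs ht
  have hk0 : 0 ≤ k := (norm_nonneg _).trans (hk 0)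
  rw [norm_smul, norm_neg, Complex.norm_I, one_mul]
  refine (norm_mul_le _ _).trans ?_
  exact (mul_le_mul (hk r) (h.norm_le_one hH hr) (norm_nonneg _) hk0).trans (mul_one k).le

/-- The Heisenberg equation of motion, in integrated form. -/
theorem heisenberg (h : IsPropagatorOn H U T) (hH : ∀ t, IsSelfAdjoint (H t)) (Q : A) :
    IsPrimitiveOn (fun t => star (U t) * Q * U t)
      (fun t => Complex.I • (star (U t) * (H t * Q - Q * H t) * U t)) T := by
  have h1 := (h.star_primitive hH).map (ContinuousLinearMap.mul ℝ A |>.flip Q)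
  have h2 := h1.mul h.isPrimitiveOn
  have e : (fun t => Complex.I • (star (U t) * (H t * Q - Q * H t) * U t)) = fun t =>
      Complex.I • (star (U t) * H t) * Q * U t +
        star (U t) * Q * (-Complex.I) • (H t * U t) := by
    ext t
    simp only [neg_smul, mul_neg, smul_mul_assoc, mul_smul_comm, ← sub_eq_add_neg, ← smul_sub]
    congr 1
    noncomm_ring
  rw [e]
  simpa using h2

end IsPropagatorOn

end Propagator

/-! ### Existence of propagators by Picard series, with measurable dependence on a parameter. -/

theorem stronglyMeasurable_comp_prodMk_left {E Ω : Type*} [TopologicalSpace E]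
    [MeasurableSpace Ω] {f : ℝ × Ω → E} (hf : StronglyMeasurable f) (ω : Ω) :
    StronglyMeasurable fun s => f (s, ω) :=
  hf.comp_measurable (measurable_id.prodMk measurable_const)

section Picard

variable {A Ω : Type*} [NormedRing A] [NormedAlgebra ℝ A]

/-- The terms of the Picard series of `dU/dt = B(t) U(t)`, where `B` depends on a parameter. -/
noncomputable def picardTerm (B : ℝ × Ω → A) : ℕ → ℝ × Ω → A
  | 0 => fun _ => 1
  | n + 1 => fun p => ∫ s, (Set.Ioc 0 p.1).indicator (fun s => B (s, p.2) * picardTerm B n (s, p.2)) s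

variable {B : ℝ × Ω → A} {M : ℝ}

theorem picardTerm_succ (B : ℝ × Ω → A) (n : ℕ) {t : ℝ} (ht : 0 ≤ t) (ω : Ω) :
    picardTerm B (n + 1) (t, ω) = ∫ s in (0 : ℝ)..t, B (s, ω) * picardTerm B n (s, ω) := by
  rw [picardTerm]
  beta_reduce
  rw [integral_indicator measurableSet_Ioc, intervalIntegral.integral_of_le ht]

theorem norm_picardTerm_le (hM : ∀ p, ‖B p‖ ≤ M) (n : ℕ) {t : ℝ} (ht : 0 ≤ t) (ω : Ω) :
    ‖picardTerm B n (t, ω)‖ ≤ ‖(1 : A)‖ * ((M * t) ^ n / n.factorial) := by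
  have hM0 : 0 ≤ M := (norm_nonneg _).trans (hM (0, ω))
  induction n generalizing t with
  | zero => simp [picardTerm]
  | succ n ih =>
    rw [picardTerm_succ B n ht]
    have hb : ∀ s ∈ Set.Ioc 0 t, ‖B (s, ω) * picardTerm B n (s, ω)‖ ≤
        (‖(1 : A)‖ * (M ^ (n + 1) / n.factorial)) * s ^ n := by
      intro s hs
      calc _ ≤ M * (‖(1 : A)‖ * ((M * s) ^ n / n.factorial)) :=
            (norm_mul_le _ _).trans (mul_le_mul (hM _) (ih hs.1.le) (norm_nonneg _) hM0)
        _ = _ := by rw [mul_pow]; ring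
    refine (intervalIntegral.norm_integral_le_of_norm_le ht (Eventually.of_forall hb)
      (Continuous.intervalIntegrable (by fun_prop) _ _)).trans (le_of_eq ?_)
    rw [intervalIntegral.integral_const_mul, integral_pow, Nat.factorial_succ, mul_pow]
    push_cast
    field_simp
    simp

theorem summable_picardTerm [CompleteSpace A] (hM : ∀ p, ‖B p‖ ≤ M) {t : ℝ} (ht : 0 ≤ t) (ω : Ω) :
    Summable fun n => picardTerm B n (t, ω) :=
  Summable.of_norm_bounded ((Real.summable_pow_div_factorial (M * t)).mul_left _)
    fun n => norm_picardTerm_le hM n ht ω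

/-- Each term is a full-line integral of an indicator, so the upper limit of integration is just
another parameter and measurability of parametric integrals applies. -/
theorem stronglyMeasurable_picardTerm [MeasurableSpace Ω] (hB : StronglyMeasurable B) (n : ℕ) :
    StronglyMeasurable (picardTerm B n) := by
  induction n with
  | zero => exact stronglyMeasurable_const
  | succ n ih =>
    have hswap : Measurable fun q : (ℝ × Ω) × ℝ => (q.2, q.1.2) := by fun_prop
    have hset : MeasurableSet {q : (ℝ × Ω) × ℝ | 0 < q.2 ∧ q.2 ≤ q.1.1} :=
      (measurableSet_lt measurable_const measurable_snd).inter
        (measurableSet_le measurable_snd (measurable_fst.comp measurable_fst))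
    have := ((hB.mul ih).comp_measurable hswap).indicator hset
    exact this.integral_prod_right' (ν := volume)

/-- The solution, as the sum of the Picard series, for `t ≥ 0`. -/
noncomputable def picardSum (B : ℝ × Ω → A) (p : ℝ × Ω) : A :=
  ∑' n, (Set.Ici (0 : ℝ) ×ˢ (Set.univ : Set Ω)).indicator (picardTerm B n) p

theorem picardSum_of_nonneg (B : ℝ × Ω → A) {t : ℝ} (ht : 0 ≤ t) (ω : Ω) :
    picardSum B (t, ω) = ∑' n, picardTerm B n (t, ω) := by
  unfold picardSum
  congr 1
  ext n
  rw [Set.indicator_of_mem]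
  exact ⟨ht, trivial⟩

theorem stronglyMeasurable_picardSum [CompleteSpace A] [MeasurableSpace Ω]
    (hB : StronglyMeasurable B) (hM : ∀ p, ‖B p‖ ≤ M) : StronglyMeasurable (picardSum B) := by
  refine stronglyMeasurable_of_tendsto atTop (f := fun N p => ∑ n ∈ Finset.range N,
    (Set.Ici (0 : ℝ) ×ˢ (Set.univ : Set Ω)).indicator (picardTerm B n) p) (fun N => ?_) ?_
  · exact Finset.stronglyMeasurable_fun_sum _ fun n _ =>
      (stronglyMeasurable_picardTerm hB n).indicator (measurableSet_Ici.prod MeasurableSet.univ)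
  · rw [tendsto_pi_nhds]
    rintro ⟨t, ω⟩
    refine Summable.tendsto_sum_tsum_nat ?_
    rcases le_or_gt 0 t with ht | ht
    · refine (summable_picardTerm hM ht ω).congr fun n => ?_
      rw [Set.indicator_of_mem]
      exact ⟨ht, trivial⟩
    · refine summable_zero.congr fun n => ?_
      rw [Set.indicator_of_notMem]
      rintro ⟨h, -⟩
      exact absurd h (not_le.2 ht)

theorem picardSum_eq_add_integral [CompleteSpace A] [MeasurableSpace Ω]
    (hB : StronglyMeasurable B) (hM : ∀ p, ‖B p‖ ≤ M) {t : ℝ} (ht : 0 ≤ t) (ω : Ω) :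
    picardSum B (t, ω) = 1 + ∫ s in (0 : ℝ)..t, B (s, ω) * picardSum B (s, ω) := by
  have hM0 : 0 ≤ M := (norm_nonneg _).trans (hM (0, ω))
  have key : HasSum (fun n => ∫ s in (0 : ℝ)..t, B (s, ω) * picardTerm B n (s, ω))
      (∫ s in (0 : ℝ)..t, B (s, ω) * picardSum B (s, ω)) := by
    refine intervalIntegral.hasSum_integral_of_dominated_convergence
      (fun n _ => M * (‖(1 : A)‖ * ((M * t) ^ n / n.factorial))) (fun n => ?_) (fun n => ?_) ?_ ?_ ?_
    · exact (stronglyMeasurable_comp_prodMk_left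
        (hB.mul (stronglyMeasurable_picardTerm hB n)) ω).aestronglyMeasurable
    · refine Eventually.of_forall fun s hs => ?_
      rw [Set.uIoc_of_le ht] at hs
      refine (norm_mul_le _ _).trans (mul_le_mul (hM _) ?_ (norm_nonneg _) hM0)
      refine (norm_picardTerm_le hM n hs.1.le ω).trans ?_
      have := mul_nonneg hM0 hs.1.le
      gcongr
      exact hs.2
    · exact Eventually.of_forall fun s _ =>
        ((Real.summable_pow_div_factorial (M * t)).mul_left _).mul_left _
    · exact intervalIntegrable_const
    · refine Eventually.of_forall fun s hs => ?_
      rw [Set.uIoc_of_le ht] at hs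
      rw [picardSum_of_nonneg B hs.1.le]
      exact (summable_picardTerm hM hs.1.le ω).hasSum.mul_left _
  rw [picardSum_of_nonneg B ht, (summable_picardTerm hM ht ω).tsum_eq_zero_add, ← key.tsum_eq]
  congr 1
  exact tsum_congr fun n => picardTerm_succ B n ht ω

theorem norm_picardSum_le [CompleteSpace A] (hM : ∀ p, ‖B p‖ ≤ M) {t T : ℝ}
    (ht : t ∈ Set.Icc 0 T) (ω : Ω) :
    ‖picardSum B (t, ω)‖ ≤ ∑' n : ℕ, ‖(1 : A)‖ * ((M * T) ^ n / n.factorial) := by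
  have hM0 : 0 ≤ M := (norm_nonneg _).trans (hM (0, ω))
  rw [picardSum_of_nonneg B ht.1]
  refine tsum_of_norm_bounded ((Real.summable_pow_div_factorial (M * T)).mul_left _).hasSum
    fun n => (norm_picardTerm_le hM n ht.1 ω).trans ?_
  have := mul_nonneg hM0 ht.1
  gcongr
  exact ht.2

theorem isPrimitiveOn_picardSum [CompleteSpace A] [MeasurableSpace Ω]
    (hB : StronglyMeasurable B) (hM : ∀ p, ‖B p‖ ≤ M) {T : ℝ} (hT : 0 ≤ T) (ω : Ω) :
    IsPrimitiveOn (fun t => picardSum B (t, ω)) (fun t => B (t, ω) * picardSum B (t, ω)) T := by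
  have hM0 : 0 ≤ M := (norm_nonneg _).trans (hM (0, ω))
  have hb : ∀ t ∈ Set.Icc 0 T, ‖B (t, ω) * picardSum B (t, ω)‖ ≤
      M * ∑' n : ℕ, ‖(1 : A)‖ * ((M * T) ^ n / n.factorial) := fun t ht =>
    (norm_mul_le _ _).trans
      (mul_le_mul (hM _) (norm_picardSum_le hM ht ω) (norm_nonneg _) hM0)
  refine ⟨hT, ?_, ⟨_, hb⟩, fun t ht => ?_⟩
  · rw [intervalIntegrable_iff_integrableOn_Ioc_of_le hT]
    refine Measure.integrableOn_of_bounded (by simp) (stronglyMeasurable_comp_prodMk_left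
      (hB.mul (stronglyMeasurable_picardSum hB hM)) ω).aestronglyMeasurable
      ((ae_restrict_iff' measurableSet_Ioc).2 (Eventually.of_forall fun t ht =>
        hb t (Set.Ioc_subset_Icc_self ht)))
  · have h0 := picardSum_eq_add_integral hB hM le_rfl ω
    rw [intervalIntegral.integral_same, add_zero] at h0
    rw [h0]
    exact picardSum_eq_add_integral hB hM ht.1 ω

end Picard

/-- Existence of the propagator of a bounded measurable Hamiltonian, with measurable dependence
on a parameter. -/
theorem exists_isPropagatorOn {A Ω : Type*} [CStarAlgebra A] [MeasurableSpace Ω] {H : ℝ × Ω → A}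
    (hH : StronglyMeasurable H) {M : ℝ} (hM : ∀ p, ‖H p‖ ≤ M) :
    ∃ U : ℝ × Ω → A, StronglyMeasurable U ∧
      ∀ ω T, 0 ≤ T → IsPropagatorOn (fun t => H (t, ω)) (fun t => U (t, ω)) T := by
  have hB : StronglyMeasurable fun p => (-Complex.I) • H p := hH.const_smul _
  have hBM : ∀ p, ‖(-Complex.I) • H p‖ ≤ M := fun p => by simpa [norm_smul] using hM p
  refine ⟨picardSum fun p => (-Complex.I) • H p, stronglyMeasurable_picardSum hB hBM,
    fun ω T hT => ⟨?_, ?_⟩⟩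
  · simpa using picardSum_eq_add_integral hB hBM le_rfl ω
  · simpa only [smul_mul_assoc] using isPrimitiveOn_picardSum hB hBM hT ω

/-! ### Measurability of the propagator with respect to the control path. -/

/-- A right-constant process with measurable time marginals is jointly measurable. -/
theorem measurableSet_setOf_path_eq {Ω G : Type*} [MeasurableSpace Ω] {f : ℝ → Ω → G} {t₀ : ℝ}
    (hf : ∀ u ∈ Set.Ioo 0 t₀, ∀ g, MeasurableSet {ω | f u ω = g})
    (hr : ∀ ω, ∀ t : ℝ, 0 ≤ t → ∀ᶠ s in 𝓝[>] t, f s ω = f t ω) (g : G) :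
    MeasurableSet {p : ℝ × Ω | p.1 ∈ Set.Ioo 0 t₀ ∧ f p.1 p.2 = g} := by
  -- `q n ⌊s (n + 1)⌋` is the first point of the grid of mesh `1 / (n + 1)` strictly to the right of
  -- `s`. These points tend to `s` from the right, so the sampled control is eventually equal to the
  -- control at `s`, and the set is a liminf of the measurable sets `B n`.
  let q : ℕ → ℤ → ℝ := fun n j => ((j : ℝ) + 1) / ((n : ℝ) + 1)
  let B : ℕ → Set (ℝ × Ω) := fun n =>
    ⋃ j : ℤ, {s : ℝ | ⌊s * ((n : ℝ) + 1)⌋ = j} ×ˢ {ω | q n j ∈ Set.Ioo 0 t₀ ∧ f (q n j) ω = g}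
  have hB : ∀ n, MeasurableSet (B n) := by
    intro n
    refine MeasurableSet.iUnion fun j => MeasurableSet.prod ?_ ?_
    · have : Measurable fun s : ℝ => ⌊s * ((n : ℝ) + 1)⌋ :=
        Int.measurable_floor.comp (measurable_id.mul_const _)
      exact this (measurableSet_singleton j)
    · by_cases hj : q n j ∈ Set.Ioo 0 t₀
      · simpa [hj] using hf _ hj g
      · simp [hj]
  have hBmem : ∀ n s ω, (s, ω) ∈ B n ↔ q n ⌊s * ((n : ℝ) + 1)⌋ ∈ Set.Ioo 0 t₀ ∧
      f (q n ⌊s * ((n : ℝ) + 1)⌋) ω = g := by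
    intro n s ω
    simp [B]
  have hset : {p : ℝ × Ω | p.1 ∈ Set.Ioo 0 t₀ ∧ f p.1 p.2 = g} =
      (Set.Ioo 0 t₀ ×ˢ Set.univ) ∩ ⋃ N : ℕ, ⋂ n ≥ N, B n := by
    ext ⟨s, ω⟩
    have key : 0 < s → s < t₀ → ∀ᶠ n : ℕ in atTop, q n ⌊s * ((n : ℝ) + 1)⌋ ∈ Set.Ioo 0 t₀ ∧
        f (q n ⌊s * ((n : ℝ) + 1)⌋) ω = f s ω := by
      intro hs hst
      have hgt : ∀ n : ℕ, s < q n ⌊s * ((n : ℝ) + 1)⌋ := fun n => by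
        have hn : (0 : ℝ) < (n : ℝ) + 1 := by positivity
        rw [lt_div_iff₀ hn]
        exact Int.lt_floor_add_one _
      have hle : ∀ n : ℕ, q n ⌊s * ((n : ℝ) + 1)⌋ ≤ s + 1 / ((n : ℝ) + 1) := fun n => by
        have hn : (0 : ℝ) < (n : ℝ) + 1 := by positivity
        have := Int.floor_le (s * ((n : ℝ) + 1))
        calc _ ≤ (s * ((n : ℝ) + 1) + 1) / ((n : ℝ) + 1) := by
              simp only [q]
              gcongr
          _ = _ := by field_simp
      have hlim : Tendsto (fun n : ℕ => q n ⌊s * ((n : ℝ) + 1)⌋) atTop (𝓝[>] s) := by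
        refine tendsto_nhdsWithin_iff.2 ⟨?_, Eventually.of_forall hgt⟩
        refine tendsto_of_tendsto_of_tendsto_of_le_of_le tendsto_const_nhds
          (h := fun n : ℕ => s + 1 / ((n : ℝ) + 1)) ?_ (fun n => (hgt n).le) hle
        simpa using tendsto_one_div_add_atTop_nhds_zero_nat.const_add s
      have h1 := hlim.eventually (hr ω s hs.le)
      have h2 := hlim.eventually (mem_nhdsWithin_of_mem_nhds (Ioo_mem_nhds hs hst))
      filter_upwards [h1, h2] with n h1 h2 using ⟨h2, h1⟩
    simp only [Set.mem_ofPred_eq, Set.mem_inter_iff, Set.mem_prod, Set.mem_univ, and_true,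
      Set.mem_iUnion, Set.mem_iInter, hBmem]
    refine and_congr_right fun hs => ⟨fun h => ?_, fun ⟨N, hN⟩ => ?_⟩
    · obtain ⟨N, hN⟩ := eventually_atTop.1 (key hs.1 hs.2)
      exact ⟨N, fun n hn => ⟨(hN n hn).1, (hN n hn).2.trans h⟩⟩
    · obtain ⟨n, hn, hn'⟩ := ((key hs.1 hs.2).and (eventually_ge_atTop N)).exists
      exact hn.2.symm.trans (hN n hn').2
  rw [hset]
  exact (measurableSet_Ioo.prod MeasurableSet.univ).inter
    (MeasurableSet.iUnion fun N => MeasurableSet.iInter fun n => MeasurableSet.iInter fun _ => hB n)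

section Switching

variable {A Ω G : Type*} [CStarAlgebra A] [Fintype G]

/-- The Hamiltonian `κ g t` switched by a process `f` with values `g`, cut off to the time
interval `(0, t₀)`. -/
noncomputable def switchedHamiltonian (κ : G → ℝ → A) (f : ℝ → Ω → G) (t₀ : ℝ) (p : ℝ × Ω) : A :=
  ∑ g, {p : ℝ × Ω | p.1 ∈ Set.Ioo 0 t₀ ∧ f p.1 p.2 = g}.indicator (fun p => κ g p.1) p

variable {κ : G → ℝ → A} {f : ℝ → Ω → G} {t₀ k : ℝ}

theorem switchedHamiltonian_of_mem {t : ℝ} (ht : t ∈ Set.Ioo 0 t₀) (ω : Ω) :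
    switchedHamiltonian κ f t₀ (t, ω) = κ (f t ω) t := by
  classical
  simp [switchedHamiltonian, Set.indicator_apply, ht.1, ht.2]

theorem switchedHamiltonian_of_notMem {t : ℝ} (ht : t ∉ Set.Ioo 0 t₀) (ω : Ω) :
    switchedHamiltonian κ f t₀ (t, ω) = 0 := by
  refine Finset.sum_eq_zero fun g _ => Set.indicator_of_notMem (fun h => ht ?_) _
  exact h.1

theorem norm_switchedHamiltonian_le (hk0 : 0 ≤ k) (hk : ∀ g t, ‖κ g t‖ ≤ k) (p : ℝ × Ω) :
    ‖switchedHamiltonian κ f t₀ p‖ ≤ k := by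
  by_cases hp : p.1 ∈ Set.Ioo 0 t₀
  · exact (congrArg norm (switchedHamiltonian_of_mem (κ := κ) (f := f) hp p.2)).trans_le (hk _ _)
  · exact (congrArg norm (switchedHamiltonian_of_notMem (κ := κ) (f := f) hp p.2)).trans_le (by simpa using hk0)

theorem stronglyMeasurable_switchedHamiltonian [MeasurableSpace Ω]
    (hf : ∀ u ∈ Set.Ioo 0 t₀, ∀ g, MeasurableSet {ω | f u ω = g})
    (hr : ∀ ω, ∀ t : ℝ, 0 ≤ t → ∀ᶠ s in 𝓝[>] t, f s ω = f t ω)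
    (hκ : ∀ g, StronglyMeasurable (κ g)) : StronglyMeasurable (switchedHamiltonian κ f t₀) :=
  Finset.stronglyMeasurable_fun_sum _ fun g _ =>
    ((hκ g).comp_measurable measurable_fst).indicator (measurableSet_setOf_path_eq hf hr g)

/-- The propagator at a time `t ≤ t₀` is a measurable function of the control before `t₀`. -/
theorem exists_stronglyMeasurable_propagator [MeasurableSpace Ω] [IsDedekindFiniteMonoid A]
    (hf : ∀ u ∈ Set.Ioo 0 t₀, ∀ g, MeasurableSet {ω | f u ω = g})
    (hr : ∀ ω, ∀ t : ℝ, 0 ≤ t → ∀ᶠ s in 𝓝[>] t, f s ω = f t ω)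
    (hκ : ∀ g, StronglyMeasurable (κ g)) (hk0 : 0 ≤ k) (hk : ∀ g t, ‖κ g t‖ ≤ k)
    (hsa : ∀ g t, IsSelfAdjoint (κ g t)) (ht₀ : 0 ≤ t₀) {V : Ω → ℝ → A}
    (hV : ∀ ω, IsPropagatorOn (fun t => κ (f t ω) t) (V ω) t₀) :
    ∃ W : ℝ × Ω → A, StronglyMeasurable W ∧ ∀ ω, ∀ t ∈ Set.Icc 0 t₀, V ω t = W (t, ω) := by
  -- The cut-off Hamiltonian sees the control on `(0, t₀)` only, so its Picard solution is
  -- measurable for any σ-algebra making those values measurable; uniqueness identifies it with `V`.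
  obtain ⟨W, hW, hW'⟩ := exists_isPropagatorOn
    (stronglyMeasurable_switchedHamiltonian hf hr hκ) (norm_switchedHamiltonian_le hk0 hk)
  exact ⟨W, hW, fun ω => (hV ω).eq_of_eqOn (hW' ω t₀ ht₀) (fun t => hsa _ _)
    fun t ht => (switchedHamiltonian_of_mem ht ω).symm⟩

end Switching

/-! ### Averaging over a uniform, independent group element. -/

section Averaging

variable {Ω G : Type*} [Fintype G] [MeasurableSpace G] [MeasurableSingletonClass G]

/-- Splitting according to the value of `X`, independence gives `E φ_X = ∑ P(X = g) E φ_g`, which is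
`1 / |G|` times the expectation of `∑ φ_g = 0`. -/
theorem integral_comp_uniform_eq_zero {m mΩ : MeasurableSpace Ω} {P : Measure Ω}
    {X : Ω → G} (hX : Measurable X)
    (hunif : ∀ g, P.real {ω | X ω = g} = 1 / (Fintype.card G : ℝ))
    (hind : Indep (MeasurableSpace.comap X inferInstance) m P) (hm : m ≤ mΩ)
    {φ : G → Ω → ℂ} (hφ : ∀ g, StronglyMeasurable[m] (φ g)) (hint : ∀ g, Integrable (φ g) P)
    (hsum : ∀ ω, ∑ g, φ g ω = 0) : ∫ ω, φ (X ω) ω ∂P = 0 := by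
  classical
  let χ : G → G → ℂ := fun g h => if h = g then 1 else 0
  have hχ : ∀ g, Measurable (χ g) := fun g => measurable_of_finite _
  have hdec : ∀ ω, φ (X ω) ω = ∑ g, χ g (X ω) * φ g ω := by
    intro ω
    simp [χ]
  have hχint : ∀ g, ∫ ω, χ g (X ω) ∂P = 1 / (Fintype.card G : ℂ) := by
    intro g
    have hmeas : MeasurableSet {ω | X ω = g} := hX (measurableSet_singleton g)
    have : (fun ω => χ g (X ω)) = {ω | X ω = g}.indicator fun _ => (1 : ℂ) := by
      ext ω
      simp [χ, Set.indicator_apply]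
    rw [this, integral_indicator_const _ hmeas, hunif g]
    simp
  have hbdd : ∀ g, Integrable (fun ω => χ g (X ω) * φ g ω) P := fun g => by
    refine (hint g).bdd_mul (c := 1) ((hχ g).comp hX).aestronglyMeasurable
      (Eventually.of_forall fun ω => ?_)
    by_cases h : X ω = g <;> simp [χ, h]
  have hterm : ∀ g, ∫ ω, χ g (X ω) * φ g ω ∂P = 1 / (Fintype.card G : ℂ) * ∫ ω, φ g ω ∂P := by
    intro g
    have hi : IndepFun (fun ω => χ g (X ω)) (φ g) P := by
      rw [IndepFun_iff_Indep]
      refine indep_of_indep_of_le_left (indep_of_indep_of_le_right hind ?_) ?_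
      · exact (hφ g).measurable.comap_le
      · exact ((hχ g).comp (comap_measurable X)).comap_le
    rw [hi.integral_fun_mul_eq_mul_integral ((hχ g).comp hX).aestronglyMeasurable
      ((hφ g).mono hm).aestronglyMeasurable, hχint]
  simp_rw [hdec]
  rw [integral_finsetSum _ fun g _ => hbdd g]
  simp_rw [hterm]
  rw [← Finset.mul_sum, ← integral_finsetSum _ fun g _ => hint g]
  simp [hsum]

end Averaging

/-! ### The rate of change of an observable. -/

section HeisenbergRate

variable {A : Type*} [CStarAlgebra A]

/-- The rate of change of the expectation `τ(V† Q V)` of `Q` under the Hamiltonian `K`. -/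
noncomputable def heisenbergRate (τ : A →L[ℂ] ℂ) (Q K V : A) : ℂ :=
  τ (Complex.I • (star V * (K * Q - Q * K) * V))

variable {τ : A →L[ℂ] ℂ} {Q K V V' : A} {k : ℝ}

theorem norm_commutator_le (hQ : ‖Q‖ ≤ 1) (hK : ‖K‖ ≤ k) : ‖K * Q - Q * K‖ ≤ 2 * k := by
  have h1 : ‖K * Q‖ ≤ k * 1 :=
    (norm_mul_le _ _).trans (mul_le_mul hK hQ (norm_nonneg _) ((norm_nonneg _).trans hK))
  have h2 : ‖Q * K‖ ≤ 1 * k :=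
    (norm_mul_le _ _).trans (mul_le_mul hQ hK (norm_nonneg _) zero_le_one)
  linarith [norm_sub_le (K * Q) (Q * K)]

/-- The rate is quadratic in `V`: telescoping gives two terms, each with a commutator of norm at
most `2k`, hence the constant `4k`. -/
theorem norm_heisenbergRate_sub_le (hτ : ∀ X, ‖τ X‖ ≤ ‖X‖) (hQ : ‖Q‖ ≤ 1) (hK : ‖K‖ ≤ k)
    (hV : ‖V‖ ≤ 1) (hV' : ‖V'‖ ≤ 1) :
    ‖heisenbergRate τ Q K V - heisenbergRate τ Q K V'‖ ≤ 4 * k * ‖V - V'‖ := by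
  have hC := norm_commutator_le hQ hK
  have hk : 0 ≤ k := (norm_nonneg _).trans hK
  set C := K * Q - Q * K
  have e : star V * C * V - star V' * C * V' = star V * C * (V - V') + star (V - V') * C * V' := by
    rw [star_sub]
    noncomm_ring
  have h1 : ‖star V * C * (V - V')‖ ≤ 1 * (2 * k) * ‖V - V'‖ := by
    refine (norm_mul_le _ _).trans (mul_le_mul_of_nonneg_right ((norm_mul_le _ _).trans ?_)
      (norm_nonneg _))
    exact mul_le_mul ((norm_star V).trans_le hV) hC (norm_nonneg _) zero_le_one
  have h2 : ‖star (V - V') * C * V'‖ ≤ ‖V - V'‖ * (2 * k) * 1 := by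
    refine (norm_mul_le _ _).trans (mul_le_mul ((norm_mul_le _ _).trans ?_) hV'
      (norm_nonneg _) (by positivity))
    exact mul_le_mul (norm_star _).le hC (norm_nonneg _) (norm_nonneg _)
  rw [heisenbergRate, heisenbergRate, ← map_sub, ← smul_sub, e]
  refine (hτ _).trans ?_
  rw [norm_smul, Complex.norm_I, one_mul]
  linarith [norm_add_le (star V * C * (V - V')) (star (V - V') * C * V')]

theorem norm_heisenbergRate_le (hτ : ∀ X, ‖τ X‖ ≤ ‖X‖) (hQ : ‖Q‖ ≤ 1) (hK : ‖K‖ ≤ k)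
    (hV : ‖V‖ ≤ 1) : ‖heisenbergRate τ Q K V‖ ≤ 4 * k := by
  have h := norm_heisenbergRate_sub_le hτ hQ hK hV (V' := 0) (by simp)
  have hk : 0 ≤ k := (norm_nonneg _).trans hK
  have h0 : heisenbergRate τ Q K 0 = 0 := by simp [heisenbergRate]
  rw [h0, sub_zero, sub_zero] at h
  exact h.trans (mul_le_of_le_one_right (by positivity) hV)

theorem continuous_heisenbergRate (τ : A →L[ℂ] ℂ) (Q : A) :
    Continuous fun p : A × A => heisenbergRate τ Q p.1 p.2 := by
  unfold heisenbergRate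
  fun_prop

theorem sum_heisenbergRate {ι : Type*} (s : Finset ι) (K : ι → A) :
    ∑ i ∈ s, heisenbergRate τ Q (K i) V = heisenbergRate τ Q (∑ i ∈ s, K i) V := by
  simp only [heisenbergRate, ← map_sum, ← Finset.smul_sum]
  congr 2
  rw [Finset.sum_mul, Finset.mul_sum, ← Finset.sum_sub_distrib, Finset.mul_sum, Finset.sum_mul]

end HeisenbergRate

/-! ### Second-order drift under random switching. -/

theorem BangBangControl.measurableSet_path_eq {Ω G : Type*} [MeasurableSpace Ω]
    [MeasurableSpace G] [MeasurableSingletonClass G] (γ : BangBangControl Ω G) {u : ℝ} (hu : 0 < u)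
    (g : G) : MeasurableSet {ω | γ.path u ω = g} :=
  γ.measurable u hu.le (measurableSet_singleton g)

section RandomSwitching

variable {A Ω G : Type*} [CStarAlgebra A] [IsDedekindFiniteMonoid A] [Fintype G]
  [MeasurableSpace G] [MeasurableSingletonClass G] [MeasurableSpace Ω] {P : Measure Ω}
  [IsProbabilityMeasure P] {γ : BangBangControl Ω G} {κ : G → ℝ → A} {Δt k T : ℝ}
  {V : Ω → ℝ → A} {τ : A →L[ℂ] ℂ} {Q : A}

theorem stronglyMeasurable_propagator (hκ : ∀ g, StronglyMeasurable (κ g))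
    (hk : ∀ g t, ‖κ g t‖ ≤ k) (hk0 : 0 ≤ k) (hsa : ∀ g t, IsSelfAdjoint (κ g t)) (hT : 0 ≤ T)
    (hV : ∀ ω, IsPropagatorOn (fun t => κ (γ.path t ω) t) (V ω) T) :
    StronglyMeasurable fun ω => V ω T := by
  obtain ⟨W, hW, hVW⟩ := exists_stronglyMeasurable_propagator
    (fun u hu g => γ.measurableSet_path_eq hu.1 g) γ.const_right hκ hk0 hk hsa hT hV
  rw [funext fun ω => hVW ω T ⟨hT, le_rfl⟩]
  exact hW.comp_measurable (measurable_const.prodMk measurable_id)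

/-- The propagator at `max (t - Δt) 0` is a function of control values independent of the control at
`t`, while the rate is linear in the Hamiltonian, whose group sum is zero. -/
theorem BangBangControl.IndependentBeyond.integral_heisenbergRate_eq_zero
    (hind : γ.IndependentBeyond P Δt) (hunif : γ.Uniform P) (hΔ : 0 < Δt)
    (hκ : ∀ g, StronglyMeasurable (κ g)) (hk : ∀ g t, ‖κ g t‖ ≤ k) (hk0 : 0 ≤ k)
    (hsa : ∀ g t, IsSelfAdjoint (κ g t)) (hsum : ∀ t, ∑ g, κ g t = 0)
    (hτ : ∀ X, ‖τ X‖ ≤ ‖X‖) (hQ : ‖Q‖ ≤ 1)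
    (hV : ∀ ω, IsPropagatorOn (fun t => κ (γ.path t ω) t) (V ω) T)
    {t : ℝ} (ht : t ∈ Set.Ioo 0 T) :
    ∫ ω, heisenbergRate τ Q (κ (γ.path t ω) t) (V ω (max (t - Δt) 0)) ∂P = 0 := by
  set t' := max (t - Δt) 0 with ht'
  have ht'0 : 0 ≤ t' := le_max_right _ _
  have ht'T : t' ∈ Set.Icc 0 T := ⟨ht'0, max_le (by linarith [ht.2]) (ht.1.trans ht.2).le⟩
  let Y : Ω → {s : ℝ // 0 < s ∧ Δt < |s - t|} → G := fun ω s => γ.path s ω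
  have hY : Measurable Y := measurable_pi_lambda _ fun s => γ.measurable s s.2.1.le
  -- The open interval matters: `u < t - Δt` gives the strict separation in the independence
  -- hypothesis. If `t ≤ Δt` there is no such `u`, and the propagator at time `0` is deterministic.
  have hpast : ∀ u ∈ Set.Ioo 0 t', ∀ g,
      MeasurableSet[MeasurableSpace.comap Y inferInstance] {ω | γ.path u ω = g} := by
    intro u hu g
    have hut : u < t - Δt := by
      rcases lt_max_iff.1 (ht' ▸ hu.2) with h | h
      · exact h
      · exact absurd hu.1 h.not_gt
    have hmem : 0 < u ∧ Δt < |u - t| :=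
      ⟨hu.1, by rw [abs_sub_comm]; exact (by linarith : Δt < t - u).trans_le (le_abs_self _)⟩
    exact ⟨(fun y => y ⟨u, hmem⟩) ⁻¹' {g}, measurable_pi_apply _ (measurableSet_singleton g), rfl⟩
  -- The σ-algebra on `Ω` is here the one generated by `Y`, not the ambient one.
  obtain ⟨W, hW, hVW⟩ := @exists_stronglyMeasurable_propagator A Ω G _ _ κ γ.path t' k
    (MeasurableSpace.comap Y inferInstance) _ hpast γ.const_right hκ hk0 hk hsa ht'0 V
    fun ω => (hV ω).mono ht'T
  have hVm : StronglyMeasurable[MeasurableSpace.comap Y inferInstance] fun ω => V ω t' := by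
    rw [funext fun ω => hVW ω t' ⟨ht'0, le_rfl⟩]
    exact hW.comp_measurable
      (@Measurable.prodMk _ _ _ _ _ (MeasurableSpace.comap Y inferInstance) _ _
        measurable_const measurable_id)
  have hφ : ∀ g, StronglyMeasurable[MeasurableSpace.comap Y inferInstance]
      fun ω => heisenbergRate τ Q (κ g t) (V ω t') := fun g =>
    (continuous_heisenbergRate τ Q).comp_stronglyMeasurable
      ((@stronglyMeasurable_const _ _ (MeasurableSpace.comap Y inferInstance) _ (κ g t)).prodMk hVm)
  refine integral_comp_uniform_eq_zero (γ.measurable t ht.1.le) (hunif t ht.1.le)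
    ((IndepFun_iff_Indep _ _ _).1 (hind t ht.1)) hY.comap_le
    (φ := fun g ω => heisenbergRate τ Q (κ g t) (V ω t')) hφ (fun g => ?_) fun ω => ?_
  · refine Integrable.of_bound ((hφ g).mono hY.comap_le).aestronglyMeasurable (4 * k)
      (Eventually.of_forall fun ω => ?_)
    exact norm_heisenbergRate_le hτ hQ (hk g t) ((hV ω).norm_le_one (fun _ => hsa _ _) ht'T)
  · rw [sum_heisenbergRate, hsum]
    simp [heisenbergRate]

/-- Subtracting the mean-zero rate at the earlier propagator leaves `4k` times a displacement of at
most `kΔt`. -/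
theorem BangBangControl.IndependentBeyond.norm_integral_heisenbergRate_le
    (hind : γ.IndependentBeyond P Δt) (hunif : γ.Uniform P) (hΔ : 0 < Δt)
    (hκ : ∀ g, StronglyMeasurable (κ g)) (hk : ∀ g t, ‖κ g t‖ ≤ k) (hk0 : 0 ≤ k)
    (hsa : ∀ g t, IsSelfAdjoint (κ g t)) (hsum : ∀ t, ∑ g, κ g t = 0)
    (hτ : ∀ X, ‖τ X‖ ≤ ‖X‖) (hQ : ‖Q‖ ≤ 1)
    (hV : ∀ ω, IsPropagatorOn (fun t => κ (γ.path t ω) t) (V ω) T)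
    {t : ℝ} (ht : t ∈ Set.Ioo 0 T) :
    ‖∫ ω, heisenbergRate τ Q (κ (γ.path t ω) t) (V ω t) ∂P‖ ≤ 4 * k ^ 2 * Δt := by
  set t' := max (t - Δt) 0 with ht'
  have htT : t ∈ Set.Icc 0 T := Set.Ioo_subset_Icc_self ht
  have ht'T : t' ∈ Set.Icc 0 T :=
    ⟨le_max_right _ _, max_le (by linarith [ht.2]) (ht.1.trans ht.2).le⟩
  have hKm : StronglyMeasurable fun ω => κ (γ.path t ω) t := by
    have : StronglyMeasurable fun g => κ g t := StronglyMeasurable.of_discrete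
    exact this.comp_measurable (γ.measurable t ht.1.le)
  have hint : ∀ s ∈ Set.Icc 0 T,
      Integrable (fun ω => heisenbergRate τ Q (κ (γ.path t ω) t) (V ω s)) P := by
    intro s hs
    have hVm := stronglyMeasurable_propagator hκ hk hk0 hsa hs.1 fun ω => (hV ω).mono hs
    refine Integrable.of_bound ((continuous_heisenbergRate τ Q).comp_stronglyMeasurable
      (hKm.prodMk hVm)).aestronglyMeasurable (4 * k) (Eventually.of_forall fun ω => ?_)
    exact norm_heisenbergRate_le hτ hQ (hk _ t) ((hV ω).norm_le_one (fun _ => hsa _ _) hs)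
  have hzero := hind.integral_heisenbergRate_eq_zero hunif hΔ hκ hk hk0 hsa hsum hτ hQ hV ht
  rw [← sub_zero (∫ ω, heisenbergRate τ Q (κ (γ.path t ω) t) (V ω t) ∂P), ← hzero,
    ← integral_sub (hint t htT) (hint t' ht'T)]
  refine (norm_integral_le_of_norm_le_const (C := 4 * k ^ 2 * Δt)
    (Eventually.of_forall fun ω => ?_)).trans (by simp)
  have h1 := norm_heisenbergRate_sub_le hτ hQ (hk (γ.path t ω) t)
    ((hV ω).norm_le_one (fun _ => hsa _ _) htT) ((hV ω).norm_le_one (fun _ => hsa _ _) ht'T)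
  have h2 := (hV ω).norm_sub_le (fun _ => hsa _ _) (fun _ => hk _ _) ht'T htT
  have h3 : |t - t'| ≤ Δt := by
    rw [abs_le]
    rcases max_cases (t - Δt) 0 with h | h <;> constructor <;> linarith [ht.1]
  calc _ ≤ 4 * k * ‖V ω t - V ω t'‖ := h1
    _ ≤ 4 * k * (k * Δt) := by
      gcongr
      exact h2.trans (by gcongr)
    _ = _ := by ring

/-- The expectation of a quantity under randomly switched dynamics drifts at a rate of second
order in the Hamiltonian. -/
theorem BangBangControl.IndependentBeyond.norm_integral_sub_le
    (hind : γ.IndependentBeyond P Δt) (hunif : γ.Uniform P) (hΔ : 0 < Δt)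
    (hκ : ∀ g, StronglyMeasurable (κ g)) (hk : ∀ g t, ‖κ g t‖ ≤ k) (hk0 : 0 ≤ k)
    (hsa : ∀ g t, IsSelfAdjoint (κ g t)) (hsum : ∀ t, ∑ g, κ g t = 0)
    (hτ : ∀ X, ‖τ X‖ ≤ ‖X‖) (hQ : ‖Q‖ ≤ 1) (hT : 0 ≤ T)
    (hV : ∀ ω, IsPropagatorOn (fun t => κ (γ.path t ω) t) (V ω) T) :
    ‖∫ ω, (τ (star (V ω T) * Q * V ω T) - τ Q) ∂P‖ ≤ 4 * T * Δt * k ^ 2 := by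
  obtain ⟨W, hW, hVW⟩ := exists_stronglyMeasurable_propagator
    (fun u hu g => γ.measurableSet_path_eq hu.1 g) γ.const_right hκ hk0 hk hsa hT hV
  let K := switchedHamiltonian κ γ.path T
  have hK : StronglyMeasurable K := stronglyMeasurable_switchedHamiltonian
    (fun u hu g => γ.measurableSet_path_eq hu.1 g) γ.const_right hκ
  -- The rate is written with the jointly measurable versions `K` and `W`, so that Fubini applies.
  let r : Ω → ℝ → ℂ := fun ω t => heisenbergRate τ Q (K (t, ω)) (W (t, ω))
  have hr : ∀ ω, ∀ t ∈ Set.Ioo 0 T,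
      r ω t = heisenbergRate τ Q (κ (γ.path t ω) t) (V ω t) := fun ω t ht => by
    simp only [r, K]
    rw [switchedHamiltonian_of_mem ht, hVW ω t (Set.Ioo_subset_Icc_self ht)]
  have hev : ∀ ω, τ (star (V ω T) * Q * V ω T) - τ Q = ∫ t in Set.Ioo 0 T, r ω t := by
    intro ω
    have h1 := (((hV ω).heisenberg (fun _ => hsa _ _) Q).map (τ.restrictScalars ℝ)).eq_add T
      ⟨hT, le_rfl⟩
    simp only [(hV ω).zero, star_one, one_mul, mul_one, ContinuousLinearMap.coe_restrictScalars'] at h1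
    rw [h1, add_sub_cancel_left, intervalIntegral.integral_of_le hT, integral_Ioc_eq_integral_Ioo]
    exact setIntegral_congr_fun measurableSet_Ioo fun t ht => (hr ω t ht).symm
  have hint : Integrable (Function.uncurry r) (P.prod (volume.restrict (Set.Ioo 0 T))) := by
    refine Integrable.of_bound ((continuous_heisenbergRate τ Q).comp_stronglyMeasurable
      ((hK.prodMk hW).comp_measurable measurable_swap)).aestronglyMeasurable (4 * k) ?_
    have hmem : ∀ᵐ p : Ω × ℝ ∂(P.prod (volume.restrict (Set.Ioo 0 T))), p.2 ∈ Set.Ioo 0 T :=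
      Measure.quasiMeasurePreserving_snd.ae (ae_restrict_mem measurableSet_Ioo)
    filter_upwards [hmem] with p hp
    rw [Function.uncurry_def]
    beta_reduce
    rw [hr p.1 p.2 hp]
    exact norm_heisenbergRate_le hτ hQ (hk _ _)
      ((hV p.1).norm_le_one (fun _ => hsa _ _) (Set.Ioo_subset_Icc_self hp))
  simp_rw [hev]
  rw [integral_integral_swap hint]
  refine (norm_setIntegral_le_of_norm_le_const (C := 4 * k ^ 2 * Δt) (by simp)
    fun t ht => ?_).trans (le_of_eq ?_)
  · simp_rw [hr _ t ht]
    exact hind.norm_integral_heisenbergRate_le hunif hΔ hκ hk hk0 hsa hsum hτ hQ hV ht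
  · rw [Real.volume_real_Ioo_of_le hT]
    ring

end RandomSwitching

/-! ### Schur's lemma and the group average of a traceless matrix. -/

section GroupAverage

variable {G S : Type*} [Group G] [Fintype S] [DecidableEq S]

/-- Schur's lemma: a matrix that commutes with an irreducible projective representation is
scalar. -/
theorem DecouplingGroup.Irreducible.eq_smul_one [Nonempty S] {R : DecouplingGroup G S}
    (hR : R.Irreducible) {M : Matrix S S ℂ}
    (hM : ∀ g, M * (R.op g : Matrix S S ℂ) = (R.op g : Matrix S S ℂ) * M) :
    ∃ c : ℂ, M = c • 1 := by
  obtain ⟨c, hc⟩ := Module.End.exists_eigenvalue (Matrix.toLin' M)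
  refine ⟨c, ?_⟩
  have hmem : ∀ v, v ∈ Module.End.eigenspace (Matrix.toLin' M) c ↔ M *ᵥ v = c • v := fun v => by
    rw [Module.End.mem_eigenspace_iff, Matrix.toLin'_apply]
  have hinv := hR (Module.End.eigenspace (Matrix.toLin' M) c) fun g v hv => by
    rw [hmem] at hv ⊢
    rw [Matrix.mulVec_mulVec, hM, ← Matrix.mulVec_mulVec, hv, Matrix.mulVec_smul]
  have htop := hinv.resolve_left hc
  refine Matrix.toLin'.injective (LinearMap.ext fun v => ?_)
  have hv := (hmem v).1 (htop ▸ Submodule.mem_top)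
  simpa using hv

/-- The phase of the projective representation has modulus one by unitarity, so it cancels under
conjugation. -/
theorem DecouplingGroup.op_mul_conj [Nonempty S] (R : DecouplingGroup G S) (X : Matrix S S ℂ)
    (g h : G) : (R.op (g * h) : Matrix S S ℂ)ᴴ * X * (R.op (g * h) : Matrix S S ℂ) =
      (R.op h : Matrix S S ℂ)ᴴ * ((R.op g : Matrix S S ℂ)ᴴ * X * (R.op g : Matrix S S ℂ)) *
        (R.op h : Matrix S S ℂ) := by
  obtain ⟨c, hc⟩ := R.map_mul g h
  have hu : ∀ g, (R.op g : Matrix S S ℂ)ᴴ * (R.op g : Matrix S S ℂ) = 1 := fun g =>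
    Unitary.coe_star_mul_self (R.op g)
  have hcc : star c * c = 1 := by
    have h1 := hu (g * h)
    rw [hc, Matrix.conjTranspose_smul, Matrix.conjTranspose_mul, smul_mul_smul_comm,
      Matrix.mul_assoc, ← Matrix.mul_assoc _ (R.op g : Matrix S S ℂ), hu, Matrix.one_mul, hu] at h1
    obtain ⟨i⟩ := ‹Nonempty S›
    simpa using congrFun (congrFun h1 i) i
  rw [hc, Matrix.conjTranspose_smul, Matrix.conjTranspose_mul, Matrix.smul_mul,
    smul_mul_smul_comm, hcc, one_smul]
  simp only [Matrix.mul_assoc]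

/-- The average of a traceless matrix over an irreducible group vanishes. -/
theorem DecouplingGroup.Irreducible.sum_conj_eq_zero [Nonempty S] [Fintype G]
    {R : DecouplingGroup G S} (hR : R.Irreducible) {X : Matrix S S ℂ} (hX : X.trace = 0) :
    ∑ g, (R.op g : Matrix S S ℂ)ᴴ * X * (R.op g : Matrix S S ℂ) = 0 := by
  have hu : ∀ g, (R.op g : Matrix S S ℂ) * (R.op g : Matrix S S ℂ)ᴴ = 1 := fun g =>
    Unitary.coe_mul_star_self (R.op g)
  -- Reindexing by `g ↦ g h` shows that the sum is invariant under conjugation by each `R.op h`,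
  -- hence scalar; its trace is zero term by term.
  obtain ⟨c, hc⟩ := hR.eq_smul_one
    (M := ∑ g, (R.op g : Matrix S S ℂ)ᴴ * X * (R.op g : Matrix S S ℂ)) fun h => by
      have : ∑ g, (R.op g : Matrix S S ℂ)ᴴ * X * (R.op g : Matrix S S ℂ) =
          (R.op h : Matrix S S ℂ)ᴴ * (∑ g, (R.op g : Matrix S S ℂ)ᴴ * X * (R.op g : Matrix S S ℂ)) *
            (R.op h : Matrix S S ℂ) := by
        conv_lhs => rw [← Equiv.sum_comp (Equiv.mulRight h)]
        simp only [Equiv.coe_mulRight, R.op_mul_conj, Finset.mul_sum, Finset.sum_mul]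
      conv_rhs => rw [this]
      rw [← Matrix.mul_assoc, ← Matrix.mul_assoc, hu, Matrix.one_mul]
  have htr := congrArg Matrix.trace hc
  rw [Matrix.trace_sum, Finset.sum_eq_zero fun g _ => by
    rw [Matrix.trace_mul_cycle, hu, Matrix.one_mul, hX]] at htr
  have hc0 : c = 0 := by
    simpa [Matrix.trace_smul, Matrix.trace_one, Fintype.card_ne_zero] using htr.symm
  rw [hc, hc0, zero_smul]

end GroupAverage

/-! ### Density matrices as functionals of norm at most one. -/

section States

variable {N : Type*} [Fintype N] [DecidableEq N]

theorem Matrix.norm_star_dotProduct_mulVec_le (X : Matrix N N ℂ) (v : N → ℂ) :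
    ‖star v ⬝ᵥ X *ᵥ v‖ ≤ ‖X‖ * (star v ⬝ᵥ v).re := by
  have h1 := norm_inner_le_norm (𝕜 := ℂ) (WithLp.toLp 2 v) (WithLp.toLp 2 (X *ᵥ v))
  have h2 := X.l2_opNorm_mulVec (WithLp.toLp 2 v)
  have h3 : (star v ⬝ᵥ v).re = ‖WithLp.toLp 2 v‖ ^ 2 := by
    rw [EuclideanSpace.norm_sq_eq, dotProduct, Complex.re_sum]
    refine Finset.sum_congr rfl fun i _ => ?_
    rw [Pi.star_apply, RCLike.star_def, Complex.conj_mul', ← Complex.ofReal_pow, Complex.ofReal_re]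
  rw [EuclideanSpace.inner_toLp_toLp, dotProduct_comm] at h1
  rw [h3]
  refine h1.trans ?_
  calc _ ≤ ‖WithLp.toLp 2 v‖ * (‖X‖ * ‖WithLp.toLp 2 v‖) := by gcongr; exact h2
    _ = _ := by ring

/-- The expectation in a density matrix is bounded by the operator norm. -/
theorem Matrix.PosSemidef.norm_trace_mul_le {σ : Matrix N N ℂ} (hσ : σ.PosSemidef)
    (htr : σ.trace = 1) (X : Matrix N N ℂ) : ‖(σ * X).trace‖ ≤ ‖X‖ := by
  obtain ⟨m, v, rfl⟩ := Matrix.posSemidef_iff_eq_sum_vecMulVec.1 hσ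
  have htr' : ∑ i, (star (v i) ⬝ᵥ v i).re = 1 := by
    rw [← Complex.re_sum, ← Complex.one_re, ← htr, Matrix.trace_sum]
    simp only [Matrix.trace_vecMulVec, dotProduct_comm]
  have he : ∀ i, (Matrix.vecMulVec (v i) (star (v i)) * X).trace = star (v i) ⬝ᵥ X *ᵥ v i := by
    intro i
    rw [Matrix.vecMulVec_mul, Matrix.trace_vecMulVec, dotProduct_comm, Matrix.dotProduct_mulVec]
  rw [Finset.sum_mul, Matrix.trace_sum]
  calc _ ≤ ∑ i, ‖X‖ * (star (v i) ⬝ᵥ v i).re :=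
        norm_sum_le_of_le _ fun i _ => by
          rw [he]
          exact X.norm_star_dotProduct_mulVec_le (v i)
    _ = ‖X‖ := by rw [← Finset.mul_sum, htr', mul_one]

/-- The linear functional `X ↦ tr(σ X)`. -/
noncomputable def densityFunctional (σ : Matrix N N ℂ) : Matrix N N ℂ →L[ℂ] ℂ :=
  LinearMap.toContinuousLinearMap (Matrix.traceLinearMap N ℂ ℂ ∘ₗ LinearMap.mulLeft ℂ σ)

theorem densityFunctional_apply (σ X : Matrix N N ℂ) :
    densityFunctional σ X = (σ * X).trace := rfl

end States

/-! ### The escape probability as the expectation of an observable. -/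

section EscapeProbability

variable {S E : Type*} [Fintype S] [Fintype E] [DecidableEq E]

theorem trace_mul_partialTraceEnv (X : Matrix S S ℂ) (M : Matrix (S × E) (S × E) ℂ) :
    (X * partialTraceEnv M).trace = ((X ⊗ₖ (1 : Matrix E E ℂ)) * M).trace := by
  simp only [Matrix.trace, Matrix.diag, Matrix.mul_apply, partialTraceEnv, Matrix.of_apply,
    Fintype.sum_prod_type, Matrix.kroneckerMap_apply, Matrix.one_apply, mul_ite, mul_one, mul_zero,
    ite_mul, zero_mul, Finset.sum_ite_eq, Finset.mem_univ, if_true, Finset.mul_sum]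
  exact Finset.sum_congr rfl fun _ _ => Finset.sum_comm

theorem isHermitian_pureState {S : Type*} (ψ : EuclideanSpace ℂ S) : (pureState ψ).IsHermitian := by
  ext i j
  simp [pureState, Matrix.vecMulVec_apply, mul_comm]

theorem star_dotProduct_self_of_norm_eq_one {ψ : EuclideanSpace ℂ S} (hψ : ‖ψ‖ = 1) :
    (fun i => star (ψ i)) ⬝ᵥ (fun i => ψ i) = (1 : ℂ) := by
  have h := EuclideanSpace.norm_sq_eq ψ
  rw [hψ, one_pow] at h
  rw [dotProduct, ← Complex.ofReal_one, h, Complex.ofReal_sum]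
  exact Finset.sum_congr rfl fun i _ => by
    rw [RCLike.star_def, Complex.conj_mul', Complex.ofReal_pow]

theorem pureState_mul_self {ψ : EuclideanSpace ℂ S} (hψ : ‖ψ‖ = 1) :
    pureState ψ * pureState ψ = pureState ψ := by
  rw [pureState, Matrix.vecMulVec_mul_vecMulVec, star_dotProduct_self_of_norm_eq_one hψ]
  simp

theorem trace_pureState {ψ : EuclideanSpace ℂ S} (hψ : ‖ψ‖ = 1) : (pureState ψ).trace = 1 := by
  rw [pureState, Matrix.trace_vecMulVec, dotProduct_comm, star_dotProduct_self_of_norm_eq_one hψ]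

variable [DecidableEq S]

/-- The observable `π⊥ ⊗ I`, where `π = |ψ⟩⟨ψ|`. -/
noncomputable def escapeObservable (E : Type*) [DecidableEq E] (ψ : EuclideanSpace ℂ S) :
    Matrix (S × E) (S × E) ℂ :=
  (1 - pureState ψ) ⊗ₖ (1 : Matrix E E ℂ)

theorem escapeProbability_eq (ρE : Matrix E E ℂ) (V : Matrix (S × E) (S × E) ℂ)
    (ψ : EuclideanSpace ℂ S) : escapeProbability ρE V ψ =
      (densityFunctional (pureState ψ ⊗ₖ ρE) (star V * escapeObservable E ψ * V)).re := by
  rw [escapeProbability, trace_mul_partialTraceEnv, densityFunctional_apply, escapeObservable,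
    Matrix.star_eq_conjTranspose, Matrix.trace_mul_comm]
  congr 1
  rw [Matrix.mul_assoc, Matrix.mul_assoc, Matrix.trace_mul_comm]
  simp only [Matrix.mul_assoc]

/-- The observable is an orthogonal projection, so its norm equals its own square. -/
theorem norm_escapeObservable_le {ψ : EuclideanSpace ℂ S} (hψ : ‖ψ‖ = 1) :
    ‖escapeObservable E ψ‖ ≤ 1 := by
  have h1 : star (escapeObservable E ψ) * escapeObservable E ψ = escapeObservable E ψ := by
    rw [escapeObservable, Matrix.star_eq_conjTranspose, Matrix.conjTranspose_kronecker,
      Matrix.conjTranspose_one, Matrix.conjTranspose_sub, Matrix.conjTranspose_one,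
      (isHermitian_pureState ψ).eq, ← Matrix.mul_kronecker_mul, Matrix.one_mul]
    congr 1
    rw [mul_sub, sub_mul, sub_mul, pureState_mul_self hψ]
    simp
  have h2 := CStarRing.norm_star_mul_self (x := escapeObservable E ψ)
  rw [h1] at h2
  by_contra! h
  nlinarith

theorem densityFunctional_escapeObservable (ρE : Matrix E E ℂ) {ψ : EuclideanSpace ℂ S}
    (hψ : ‖ψ‖ = 1) : densityFunctional (pureState ψ ⊗ₖ ρE) (escapeObservable E ψ) = 0 := by
  rw [densityFunctional_apply, escapeObservable, ← Matrix.mul_kronecker_mul, mul_sub,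
    pureState_mul_self hψ]
  simp

theorem norm_densityFunctional_le {ρE : Matrix E E ℂ} (hρ : ρE.PosSemidef) (htr : ρE.trace = 1)
    {ψ : EuclideanSpace ℂ S} (hψ : ‖ψ‖ = 1) (X : Matrix (S × E) (S × E) ℂ) :
    ‖densityFunctional (pureState ψ ⊗ₖ ρE) X‖ ≤ ‖X‖ := by
  rw [densityFunctional_apply]
  refine Matrix.PosSemidef.norm_trace_mul_le (Matrix.PosSemidef.kronecker ?_ hρ) ?_ X
  · exact Matrix.posSemidef_vecMulVec_self_star _
  · rw [Matrix.trace_kronecker, trace_pureState hψ, htr, one_mul]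

theorem continuous_escapeProbability (ρE : Matrix E E ℂ) :
    Continuous fun p : Matrix (S × E) (S × E) ℂ × EuclideanSpace ℂ S =>
      escapeProbability ρE p.1 p.2 := by
  have hk : ∀ {X : Type _} [TopologicalSpace X], ∀ {f : X → Matrix S S ℂ}, Continuous f →
      ∀ M : Matrix E E ℂ, Continuous fun x => f x ⊗ₖ M := fun hf M =>
    continuous_matrix fun i j => (hf.matrix_elem _ _).mul continuous_const
  have hp : Continuous fun p : Matrix (S × E) (S × E) ℂ × EuclideanSpace ℂ S => pureState p.2 := by
    refine continuous_matrix fun i j => ?_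
    simp only [pureState, Matrix.vecMulVec_apply]
    fun_prop
  simp only [escapeProbability, trace_mul_partialTraceEnv]
  have h1 := hk ((continuous_const (y := (1 : Matrix S S ℂ))).sub hp) (1 : Matrix E E ℂ)
  have h2 := (continuous_fst.mul (hk hp ρE)).mul continuous_fst.star
  exact Complex.continuous_re.comp (h1.mul h2).matrix_trace

end EscapeProbability

/-! ### Interaction picture with respect to the environment Hamiltonian. -/

section InteractionPicture

variable {A : Type*} [CStarAlgebra A] {E₀ : A}

/-- The unitary group `exp(i t E₀)` of a Hamiltonian `E₀`. -/
noncomputable def expEvolution (E₀ : A) (t : ℝ) : A :=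
  NormedSpace.exp (t • (Complex.I • E₀))

theorem expEvolution_zero (E₀ : A) : expEvolution E₀ 0 = 1 := by
  simp [expEvolution]

theorem expEvolution_mem_unitary (hE : IsSelfAdjoint E₀) (t : ℝ) :
    expEvolution E₀ t ∈ unitary A := by
  let : NormedAlgebra ℚ A := NormedAlgebra.restrictScalars ℚ ℂ A
  refine NormedSpace.exp_mem_unitary_of_mem_skewAdjoint (skewAdjoint.mem_iff.2 ?_)
  simp [star_smul, hE.star_eq]

theorem hasDerivAt_expEvolution (E₀ : A) (t : ℝ) :
    HasDerivAt (expEvolution E₀) (expEvolution E₀ t * (Complex.I • E₀)) t :=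
  hasDerivAt_exp_smul_const (Complex.I • E₀) t

theorem continuous_expEvolution (E₀ : A) : Continuous (expEvolution E₀) :=
  continuous_iff_continuousAt.2 fun t => (hasDerivAt_expEvolution E₀ t).continuousAt

theorem commute_expEvolution {Q : A} (hQ : Commute Q E₀) (t : ℝ) :
    Commute Q (expEvolution E₀ t) :=
  ((hQ.smul_right _).smul_right _).exp_right

/-- Passing to the interaction picture with respect to `E₀`. -/
theorem IsPropagatorOn.interactionPicture {K U : ℝ → A} {T : ℝ} (hE : IsSelfAdjoint E₀)
    (h : IsPropagatorOn (fun t => K t + E₀) U T) :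
    IsPropagatorOn (fun t => expEvolution E₀ t * K t * star (expEvolution E₀ t))
      (fun t => expEvolution E₀ t * U t) T := by
  have hexp : IsPrimitiveOn (expEvolution E₀) (fun t => expEvolution E₀ t * (Complex.I • E₀)) T :=
    IsPrimitiveOn.of_hasDerivAt h.isPrimitiveOn.nonneg (hasDerivAt_expEvolution E₀)
      ((continuous_expEvolution E₀).mul continuous_const)
  refine ⟨by simp [expEvolution_zero, h.zero], ?_⟩
  have e : (fun t => (-Complex.I) • (expEvolution E₀ t * K t * star (expEvolution E₀ t) *
      (expEvolution E₀ t * U t))) = fun t => expEvolution E₀ t * (Complex.I • E₀) * U t +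
        expEvolution E₀ t * (-Complex.I) • ((K t + E₀) * U t) := by
    ext t
    have hu := (Unitary.mem_iff.1 (expEvolution_mem_unitary hE t)).1
    have h1 : expEvolution E₀ t * K t * star (expEvolution E₀ t) * (expEvolution E₀ t * U t) =
        expEvolution E₀ t * (K t * U t) := by
      rw [mul_assoc (expEvolution E₀ t * K t), ← mul_assoc (star _), hu, one_mul, mul_assoc]
    rw [h1]
    simp only [neg_smul, mul_neg, smul_mul_assoc, mul_smul_comm, add_mul, mul_add, smul_add,
      mul_assoc]
    abel
  rw [e]
  exact hexp.mul h.isPrimitiveOn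

theorem norm_expEvolution_conj_le (hE : IsSelfAdjoint E₀) (t : ℝ) (X : A) :
    ‖expEvolution E₀ t * X * star (expEvolution E₀ t)‖ ≤ ‖X‖ := by
  have hu := expEvolution_mem_unitary hE t
  rw [CStarRing.norm_mul_mem_unitary _ (Unitary.star_mem hu), CStarRing.norm_mem_unitary_mul _ hu]

/-- This is why the size of `H_E` does not enter the final bound. -/
theorem star_expEvolution_mul_conj (hE : IsSelfAdjoint E₀) {Q : A} (hQ : Commute Q E₀) (t : ℝ)
    (U : A) : star (expEvolution E₀ t * U) * Q * (expEvolution E₀ t * U) = star U * Q * U := by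
  have hu := (Unitary.mem_iff.1 (expEvolution_mem_unitary hE t)).1
  have h := (commute_expEvolution hQ t).eq
  set e := expEvolution E₀ t
  calc star (e * U) * Q * (e * U) = star U * (star e * (Q * e)) * U := by
        rw [star_mul]
        noncomm_ring
    _ = star U * Q * U := by rw [h, ← mul_assoc (star e), hu, one_mul]

theorem norm_conj_le_of_mem_unitary {u : A} (hu : u ∈ unitary A) (X : A) :
    ‖star u * X * u‖ ≤ ‖X‖ := by
  rw [CStarRing.norm_mul_mem_unitary _ hu, CStarRing.norm_mem_unitary_mul _ (Unitary.star_mem hu)]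

end InteractionPicture

/-! ### Second-order drift in the presence of an unswitched term. -/

section RandomSwitchingWithEnvironment

variable {A Ω G : Type*} [CStarAlgebra A] [IsDedekindFiniteMonoid A] [Fintype G]
  [MeasurableSpace G] [MeasurableSingletonClass G] [MeasurableSpace Ω] {P : Measure Ω}
  [IsProbabilityMeasure P] {γ : BangBangControl Ω G} {κ : G → ℝ → A} {Δt k T : ℝ}
  {U : Ω → ℝ → A} {τ : A →L[ℂ] ℂ} {Q E₀ : A}

/-- The expectation of an observable that commutes with the unswitched part `E₀` of the
Hamiltonian drifts at a rate of second order in the switched part `κ`. -/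
theorem BangBangControl.IndependentBeyond.integral_re_le
    (hind : γ.IndependentBeyond P Δt) (hunif : γ.Uniform P) (hΔ : 0 < Δt)
    (hκ : ∀ g, StronglyMeasurable (κ g)) (hk : ∀ g t, ‖κ g t‖ ≤ k) (hk0 : 0 ≤ k)
    (hsa : ∀ g t, IsSelfAdjoint (κ g t)) (hsum : ∀ t, ∑ g, κ g t = 0) (hE : IsSelfAdjoint E₀)
    (hτ : ∀ X, ‖τ X‖ ≤ ‖X‖) (hQ : ‖Q‖ ≤ 1) (hQE : Commute Q E₀) (hτQ : τ Q = 0) (hT : 0 ≤ T)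
    (hU : ∀ ω, IsPropagatorOn (fun t => κ (γ.path t ω) t + E₀) (U ω) T) :
    ∫ ω, (τ (star (U ω T) * Q * U ω T)).re ∂P ≤ 4 * T * Δt * k ^ 2 := by
  have hexp := continuous_expEvolution E₀
  -- The conjugating unitary depends on `t` but not on `g`, so the conjugated family still has norm
  -- at most `k` and zero group sum.
  have hmain := hind.norm_integral_sub_le hunif hΔ
    (κ := fun g t => expEvolution E₀ t * κ g t * star (expEvolution E₀ t))
    (fun g => (hexp.stronglyMeasurable.mul (hκ g)).mul hexp.star.stronglyMeasurable)
    (fun g t => (norm_expEvolution_conj_le hE t _).trans (hk g t)) hk0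
    (fun g t => (hsa g t).conjugate _)
    (fun t => by rw [← Finset.sum_mul, ← Finset.mul_sum, hsum, mul_zero, zero_mul])
    hτ hQ hT (fun ω => (hU ω).interactionPicture hE)
  simp only [hτQ, sub_zero, star_expEvolution_mul_conj hE hQE] at hmain
  have hsaU : ∀ g t, IsSelfAdjoint (κ g t + E₀) := fun g t => (hsa g t).add hE
  have hUm : StronglyMeasurable fun ω => U ω T :=
    stronglyMeasurable_propagator (κ := fun g t => κ g t + E₀) (k := k + ‖E₀‖)
      (fun g => (hκ g).add stronglyMeasurable_const)
      (fun g t => (norm_add_le _ _).trans (by gcongr; exact hk g t))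
      (by positivity) hsaU hT hU
  have hU1 : ∀ ω, ‖U ω T‖ ≤ 1 := fun ω => (hU ω).norm_le_one (fun _ => hsaU _ _) ⟨hT, le_rfl⟩
  have hcont : Continuous fun V : A => τ (star V * Q * V) := by fun_prop
  have hint : Integrable (fun ω => τ (star (U ω T) * Q * U ω T)) P := by
    refine Integrable.of_bound (hcont.comp_stronglyMeasurable hUm).aestronglyMeasurable 1
      (Eventually.of_forall fun ω => (hτ _).trans ((norm_mul_le _ _).trans ?_))
    refine mul_le_one₀ ((norm_mul_le _ _).trans ?_) (norm_nonneg _) (hU1 ω)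
    exact mul_le_one₀ ((norm_star _).trans_le (hU1 ω)) (norm_nonneg _) hQ
  exact (integral_re hint).trans_le ((Complex.re_le_norm _).trans hmain)

end RandomSwitchingWithEnvironment

/-! ### Passage between propagators on `[0, ∞)` and on bounded intervals. -/

section GlobalPropagator

variable {N : Type*} [Fintype N] [DecidableEq N] {H H' U : ℝ → Matrix N N ℂ}

theorem isPropagator_of_isPropagatorOn (h : ∀ T, 0 ≤ T → IsPropagatorOn H U T)
    (hH : ∀ t, 0 < t → H t = H' t) : IsPropagator H' U := by
  refine ⟨fun x hx => ?_, fun t ht => ?_⟩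
  · have hx1 : x ∈ Set.Icc 0 (x + 1) := ⟨hx, by linarith⟩
    refine ((h (x + 1) (hx.trans hx1.2)).isPrimitiveOn.continuousOn x hx1).mono_of_mem_nhdsWithin ?_
    rw [← Set.Ici_inter_Iic]
    exact inter_mem self_mem_nhdsWithin (mem_nhdsWithin_of_mem_nhds (Iic_mem_nhds (by linarith)))
  · have := (h t ht).isPrimitiveOn.eq_add t ⟨ht, le_rfl⟩
    rw [(h t ht).zero] at this
    rw [this]
    congr 1
    refine intervalIntegral.integral_congr_ae (Eventually.of_forall fun s hs => ?_)
    rw [Set.uIoc_of_le ht] at hs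
    rw [hH s hs.1]

/-- Only positive times enter the hypotheses on measurability and agreement, because a control path
is unconstrained at negative times. -/
theorem IsPropagator.isPropagatorOn (h : IsPropagator H' U) {M : ℝ} (hM : ∀ t, ‖H t‖ ≤ M)
    (hmeas : StronglyMeasurable ((Set.Ioi 0).indicator H)) (hH : ∀ t, 0 < t → H t = H' t)
    {T : ℝ} (hT : 0 ≤ T) : IsPropagatorOn H U T := by
  have h0 : U 0 = 1 := by simpa using h.2 0 le_rfl
  have hcont : ContinuousOn U (Set.Icc 0 T) := h.1.mono Set.Icc_subset_Ici_self
  obtain ⟨C, hC⟩ := isCompact_Icc.exists_bound_of_continuousOn hcont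
  have hb : ∀ t ∈ Set.Icc 0 T, ‖(-Complex.I) • (H t * U t)‖ ≤ M * C := fun t ht => by
    rw [norm_smul, norm_neg, Complex.norm_I, one_mul]
    exact (norm_mul_le _ _).trans
      (mul_le_mul (hM t) (hC t ht) (norm_nonneg _) ((norm_nonneg _).trans (hM 0)))
  have hHm : AEStronglyMeasurable H (volume.restrict (Set.Ioc 0 T)) := by
    refine hmeas.aestronglyMeasurable.congr ?_
    filter_upwards [ae_restrict_mem measurableSet_Ioc] with t ht
    exact Set.indicator_of_mem (s := Set.Ioi (0 : ℝ)) ht.1 H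
  have hUm : AEStronglyMeasurable U (volume.restrict (Set.Ioc 0 T)) :=
    (hcont.mono Set.Ioc_subset_Icc_self).aestronglyMeasurable measurableSet_Ioc
  refine ⟨h0, hT, ?_, ⟨_, hb⟩, fun t ht => ?_⟩
  · rw [intervalIntegrable_iff_integrableOn_Ioc_of_le hT]
    exact Integrable.of_bound ((hHm.mul hUm).const_smul (-Complex.I)) _
      ((ae_restrict_iff' measurableSet_Ioc).2 (Eventually.of_forall fun t ht =>
        hb t (Set.Ioc_subset_Icc_self ht)))
  · rw [h0, h.2 t ht.1]
    congr 1
    refine intervalIntegral.integral_congr_ae (Eventually.of_forall fun s hs => ?_)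
    rw [Set.uIoc_of_le ht.1] at hs
    rw [hH s hs.1]

theorem stronglyMeasurable_matrix {α m n : Type*} [Fintype m] [Fintype n] [MeasurableSpace α]
    {M : α → Matrix m n ℂ} (h : ∀ i j, Measurable fun a => M a i j) : StronglyMeasurable M := by
  classical
  have : M = fun a => ∑ i, ∑ j, M a i j • Matrix.single i j (1 : ℂ) := by
    ext1 a
    conv_lhs => rw [Matrix.matrix_eq_sum_single (M a)]
    simp [Matrix.smul_single]
  rw [this]
  exact Finset.stronglyMeasurable_fun_sum _ fun i _ => Finset.stronglyMeasurable_fun_sum _ fun j _ =>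
    (h i j).stronglyMeasurable.smul_const _

end GlobalPropagator

/-! ### Measurability in time along a sample path. -/

section PathMeasurability

theorem BangBangControl.stronglyMeasurable_indicator_Ioi {A Ω G : Type*} [CStarAlgebra A]
    [Fintype G] [MeasurableSpace G] [MeasurableSingletonClass G] [MeasurableSpace Ω]
    (γ : BangBangControl Ω G) {κ : G → ℝ → A} (hκ : ∀ g, StronglyMeasurable (κ g)) (ω : Ω) :
    StronglyMeasurable ((Set.Ioi 0).indicator fun t => κ (γ.path t ω) t) := by
  refine stronglyMeasurable_of_tendsto atTop
    (f := fun (n : ℕ) t => switchedHamiltonian κ γ.path (n : ℝ) (t, ω)) (fun n => ?_) ?_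
  · exact stronglyMeasurable_comp_prodMk_left (stronglyMeasurable_switchedHamiltonian
      (fun u hu g => γ.measurableSet_path_eq hu.1 g) γ.const_right hκ) ω
  · refine tendsto_pi_nhds.2 fun t => tendsto_const_nhds.congr' ?_
    filter_upwards [eventually_gt_atTop ⌈t⌉₊] with n hn
    have htn : t < n := (Nat.le_ceil t).trans_lt (by exact_mod_cast hn)
    by_cases ht : 0 < t
    · rw [Set.indicator_of_mem (Set.mem_Ioi.2 ht), switchedHamiltonian_of_mem ⟨ht, htn⟩]
    · rw [Set.indicator_of_notMem (by simpa using ht),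
        switchedHamiltonian_of_notMem (fun h => ht h.1)]

end PathMeasurability

/-! ### The interaction Hamiltonian toggled by the control. -/

namespace OpenSystem

variable {S E A G : Type*} [Fintype S] [DecidableEq S] [Fintype E] [DecidableEq E] [Fintype A]
  [Group G]

theorem drift_eq (D : OpenSystem S E A) (t : ℝ) :
    D.drift t = D.interaction t + (1 : Matrix S S ℂ) ⊗ₖ D.HE := by
  rw [drift, interaction]
  abel

theorem isHermitian_interaction (D : OpenSystem S E A) (t : ℝ) :
    (D.interaction t).IsHermitian := by
  refine Matrix.IsHermitian.add ?_ (D.coupling_hermitian t)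
  rw [Matrix.IsHermitian, Matrix.conjTranspose_kronecker, (D.HS_hermitian t).eq,
    Matrix.conjTranspose_one]

theorem isSelfAdjoint_environment (D : OpenSystem S E A) :
    IsSelfAdjoint ((1 : Matrix S S ℂ) ⊗ₖ D.HE) := by
  rw [IsSelfAdjoint, Matrix.star_eq_conjTranspose, Matrix.conjTranspose_kronecker,
    D.HE_hermitian.eq, Matrix.conjTranspose_one]

theorem stronglyMeasurable_interaction (D : OpenSystem S E A) :
    StronglyMeasurable D.interaction := by
  refine stronglyMeasurable_matrix fun i j => ?_
  simp only [interaction, Matrix.add_apply, Matrix.sum_apply, Matrix.kroneckerMap_apply]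
  exact ((D.HS_measurable _ _).mul_const _).add
    (Finset.measurable_fun_sum _ fun a _ => (D.J_measurable a _ _).mul_const _)

/-- The interaction conjugated by the control operator `g`, frozen at negative times. -/
noncomputable def toggledInteraction (D : OpenSystem S E A) (R : DecouplingGroup G S) (g : G)
    (t : ℝ) : Matrix (S × E) (S × E) ℂ :=
  star ((R.op g : Matrix S S ℂ) ⊗ₖ (1 : Matrix E E ℂ)) * D.interaction (max t 0) *
    ((R.op g : Matrix S S ℂ) ⊗ₖ (1 : Matrix E E ℂ))

theorem op_kronecker_one_mem_unitary (R : DecouplingGroup G S) (g : G) :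
    (R.op g : Matrix S S ℂ) ⊗ₖ (1 : Matrix E E ℂ) ∈ unitary (Matrix (S × E) (S × E) ℂ) :=
  Matrix.kronecker_mem_unitary (R.op g).2 (one_mem _)

variable (D : OpenSystem S E A) (R : DecouplingGroup G S)

/-- The control acts on `S` only, so it leaves `I ⊗ H_E` fixed and switches only the interaction. -/
theorem logicalHamiltonian_eq (Uc : ℝ → Matrix.unitaryGroup S ℂ) (g : G) {t : ℝ} (ht : 0 ≤ t)
    (hg : Uc t = R.op g) : D.logicalHamiltonian Uc t =
      D.toggledInteraction R g t + (1 : Matrix S S ℂ) ⊗ₖ D.HE := by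
  rw [logicalHamiltonian, toggledInteraction, drift_eq, max_eq_left ht, hg, mul_add, add_mul,
    ← Matrix.star_eq_conjTranspose]
  congr 1
  have hu : (R.op g : Matrix S S ℂ)ᴴ * (R.op g : Matrix S S ℂ) = 1 :=
    Unitary.coe_star_mul_self (R.op g)
  rw [Matrix.star_eq_conjTranspose, Matrix.conjTranspose_kronecker, Matrix.conjTranspose_one,
    ← Matrix.mul_kronecker_mul, ← Matrix.mul_kronecker_mul, Matrix.mul_one, hu, Matrix.one_mul,
    Matrix.mul_one]

theorem norm_toggledInteraction_le {k : ℝ} (hk : ∀ t, 0 ≤ t → ‖D.interaction t‖ ≤ k) (g : G)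
    (t : ℝ) : ‖D.toggledInteraction R g t‖ ≤ k := by
  have h := norm_conj_le_of_mem_unitary (op_kronecker_one_mem_unitary (E := E) R g)
    (D.interaction (max t 0))
  rw [toggledInteraction]
  exact h.trans (hk _ (le_max_right _ _))

theorem isSelfAdjoint_toggledInteraction (g : G) (t : ℝ) :
    IsSelfAdjoint (D.toggledInteraction R g t) :=
  IsSelfAdjoint.conjugate' (D.isHermitian_interaction _) _

theorem stronglyMeasurable_toggledInteraction (g : G) :
    StronglyMeasurable (D.toggledInteraction R g) :=
  (stronglyMeasurable_const.mul (D.stronglyMeasurable_interaction.comp_measurable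
    (measurable_id.max measurable_const))).mul stronglyMeasurable_const

theorem sum_toggledInteraction [Nonempty S] [Fintype G] {R : DecouplingGroup G S}
    (hR : R.Irreducible) (t : ℝ) : ∑ g, D.toggledInteraction R g t = 0 := by
  have hconj : ∀ (g : G) (X : Matrix S S ℂ) (Y : Matrix E E ℂ),
      star ((R.op g : Matrix S S ℂ) ⊗ₖ (1 : Matrix E E ℂ)) * (X ⊗ₖ Y) *
        ((R.op g : Matrix S S ℂ) ⊗ₖ (1 : Matrix E E ℂ)) =
      ((R.op g : Matrix S S ℂ)ᴴ * X * (R.op g : Matrix S S ℂ)) ⊗ₖ Y := fun g X Y => by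
    rw [Matrix.star_eq_conjTranspose, Matrix.conjTranspose_kronecker, Matrix.conjTranspose_one,
      ← Matrix.mul_kronecker_mul, ← Matrix.mul_kronecker_mul, Matrix.one_mul, Matrix.mul_one]
  have hsum : ∀ (X : Matrix S S ℂ) (Y : Matrix E E ℂ), X.trace = 0 →
      ∑ g, ((R.op g : Matrix S S ℂ)ᴴ * X * (R.op g : Matrix S S ℂ)) ⊗ₖ Y = 0 := fun X Y hX => by
    have h := hR.sum_conj_eq_zero hX
    ext i j
    simp only [Matrix.sum_apply, Matrix.kroneckerMap_apply, ← Finset.sum_mul]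
    rw [← Matrix.sum_apply, h]
    simp
  simp only [toggledInteraction, interaction, mul_add, add_mul, Finset.mul_sum, Finset.sum_mul,
    hconj, Finset.sum_add_distrib]
  rw [hsum _ _ (D.HS_trace _), Finset.sum_comm,
    Finset.sum_eq_zero fun a _ => hsum _ _ (D.J_trace a _), add_zero]

theorem norm_toggledInteraction_add_le {k : ℝ} (hk : ∀ t, 0 ≤ t → ‖D.interaction t‖ ≤ k) (g : G)
    (t : ℝ) : ‖D.toggledInteraction R g t + (1 : Matrix S S ℂ) ⊗ₖ D.HE‖ ≤
      k + ‖(1 : Matrix S S ℂ) ⊗ₖ D.HE‖ :=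
  (norm_add_le _ _).trans (add_le_add_left (D.norm_toggledInteraction_le R hk g t) _)

theorem isSelfAdjoint_toggledInteraction_add (g : G) (t : ℝ) :
    IsSelfAdjoint (D.toggledInteraction R g t + (1 : Matrix S S ℂ) ⊗ₖ D.HE) :=
  (D.isSelfAdjoint_toggledInteraction R g t).add D.isSelfAdjoint_environment

end OpenSystem

/-! ### The logical propagator and the worst-case error. -/

section LogicalPropagator

variable {S E A G Ω : Type*} [Fintype S] [DecidableEq S] [Fintype E] [DecidableEq E] [Fintype A]
  [Group G] [Fintype G] [MeasurableSpace G] [MeasurableSingletonClass G] [MeasurableSpace Ω]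
  {D : OpenSystem S E A} {R : DecouplingGroup G S} {γ : BangBangControl Ω G} {k : ℝ}

theorem stronglyMeasurable_toggled_path (D : OpenSystem S E A) (R : DecouplingGroup G S)
    (γ : BangBangControl Ω G) (ω : Ω) : StronglyMeasurable ((Set.Ioi 0).indicator fun t =>
      D.toggledInteraction R (γ.path t ω) t + (1 : Matrix S S ℂ) ⊗ₖ D.HE) :=
  γ.stronglyMeasurable_indicator_Ioi
    (κ := fun g t => D.toggledInteraction R g t + (1 : Matrix S S ℂ) ⊗ₖ D.HE)
    (fun g => (D.stronglyMeasurable_toggledInteraction R g).add stronglyMeasurable_const) ω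

theorem exists_isPropagator_logicalHamiltonian (γ : BangBangControl Ω G)
    (hk : ∀ t, 0 ≤ t → ‖D.interaction t‖ ≤ k) (ω : Ω) :
    ∃ U, IsPropagator (D.logicalHamiltonian (γ.propagator R ω)) U := by
  let H : ℝ → Matrix (S × E) (S × E) ℂ := (Set.Ioi 0).indicator fun t =>
    D.toggledInteraction R (γ.path t ω) t + (1 : Matrix S S ℂ) ⊗ₖ D.HE
  obtain ⟨U, -, hU⟩ := exists_isPropagatorOn (Ω := Unit) (H := fun p => H p.1)
    ((stronglyMeasurable_toggled_path D R γ ω).comp_measurable measurable_fst)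
    (M := k + ‖(1 : Matrix S S ℂ) ⊗ₖ D.HE‖)
    fun p => (norm_indicator_le_norm_self _ _).trans (D.norm_toggledInteraction_add_le R hk _ _)
  refine ⟨fun t => U (t, ()), isPropagator_of_isPropagatorOn (hU ()) fun t ht => ?_⟩
  rw [D.logicalHamiltonian_eq R _ (γ.path t ω) ht.le rfl]
  exact Set.indicator_of_mem (Set.mem_Ioi.2 ht) _

theorem IsPropagator.isPropagatorOn_toggled {ω : Ω} {U : ℝ → Matrix (S × E) (S × E) ℂ}
    (hU : IsPropagator (D.logicalHamiltonian (γ.propagator R ω)) U)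
    (hk : ∀ t, 0 ≤ t → ‖D.interaction t‖ ≤ k) {T : ℝ} (hT : 0 ≤ T) :
    IsPropagatorOn (fun t => D.toggledInteraction R (γ.path t ω) t +
      (1 : Matrix S S ℂ) ⊗ₖ D.HE) U T :=
  hU.isPropagatorOn (fun _ => D.norm_toggledInteraction_add_le R hk _ _)
    (stronglyMeasurable_toggled_path D R γ ω)
    (fun _ ht => (D.logicalHamiltonian_eq R _ _ ht.le rfl).symm) hT

theorem stronglyMeasurable_logicalPropagator {U : Ω → ℝ → Matrix (S × E) (S × E) ℂ}
    (hU : ∀ ω, IsPropagator (D.logicalHamiltonian (γ.propagator R ω)) (U ω))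
    (hk : ∀ t, 0 ≤ t → ‖D.interaction t‖ ≤ k) {T : ℝ} (hT : 0 ≤ T) :
    StronglyMeasurable fun ω => U ω T :=
  stronglyMeasurable_propagator
    (κ := fun g t => D.toggledInteraction R g t + (1 : Matrix S S ℂ) ⊗ₖ D.HE)
    (fun g => (D.stronglyMeasurable_toggledInteraction R g).add stronglyMeasurable_const)
    (fun g t => D.norm_toggledInteraction_add_le R hk g t)
    (add_nonneg ((norm_nonneg _).trans (hk 0 le_rfl)) (norm_nonneg _))
    (fun g t => D.isSelfAdjoint_toggledInteraction_add R g t) hT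
    fun ω => (hU ω).isPropagatorOn_toggled hk hT

theorem norm_logicalPropagator_le {U : Ω → ℝ → Matrix (S × E) (S × E) ℂ}
    (hU : ∀ ω, IsPropagator (D.logicalHamiltonian (γ.propagator R ω)) (U ω))
    (hk : ∀ t, 0 ≤ t → ‖D.interaction t‖ ≤ k) {T : ℝ} (hT : 0 ≤ T) (ω : Ω) : ‖U ω T‖ ≤ 1 :=
  ((hU ω).isPropagatorOn_toggled hk hT).norm_le_one
    (fun _ => D.isSelfAdjoint_toggledInteraction_add R _ _) ⟨hT, le_rfl⟩

theorem exists_escapeProbability_bound (ρE : Matrix E E ℂ) {K : Set (EuclideanSpace ℂ S)}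
    (hK : IsCompact K) : ∃ C, ∀ V : Matrix (S × E) (S × E) ℂ, ‖V‖ ≤ 1 → ∀ ψ ∈ K,
      ‖escapeProbability ρE V ψ‖ ≤ C := by
  have : ProperSpace (Matrix (S × E) (S × E) ℂ) := FiniteDimensional.proper ℂ _
  obtain ⟨C, hC⟩ := ((isCompact_closedBall (0 : Matrix (S × E) (S × E) ℂ) 1).prod
    hK).exists_bound_of_continuousOn (continuous_escapeProbability ρE).continuousOn
  exact ⟨C, fun V hV ψ hψ => hC (V, ψ) ⟨by simpa using hV, hψ⟩⟩

variable {P : Measure Ω} [IsProbabilityMeasure P]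

theorem integrable_escapeProbability (ρE : Matrix E E ℂ) {V : Ω → Matrix (S × E) (S × E) ℂ}
    (hV : StronglyMeasurable V) (hV1 : ∀ ω, ‖V ω‖ ≤ 1) (ψ : EuclideanSpace ℂ S) :
    Integrable (fun ω => escapeProbability ρE (V ω) ψ) P := by
  obtain ⟨C, hC⟩ := exists_escapeProbability_bound ρE (isCompact_singleton (x := ψ))
  exact Integrable.of_bound ((continuous_escapeProbability ρE).comp_stronglyMeasurable
    (hV.prodMk stronglyMeasurable_const)).aestronglyMeasurable C
    (Eventually.of_forall fun ω => hC _ (hV1 ω) ψ rfl)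

/-- The escape probability is continuous in `ψ` and uniformly bounded, so by dominated convergence
its expectation is continuous on the compact unit sphere. -/
theorem isGreatest_worstCaseError [Nonempty S] (ρE : Matrix E E ℂ)
    {V : Ω → Matrix (S × E) (S × E) ℂ} (hV : StronglyMeasurable V) (hV1 : ∀ ω, ‖V ω‖ ≤ 1) :
    IsGreatest (errorProbability P ρE V '' {ψ : EuclideanSpace ℂ S | ‖ψ‖ = 1})
      (worstCaseError P ρE V) := by
  have hsphere : {ψ : EuclideanSpace ℂ S | ‖ψ‖ = 1} = Metric.sphere 0 1 := by
    ext
    simp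
  have hcpt := isCompact_sphere (0 : EuclideanSpace ℂ S) 1
  obtain ⟨C, hC⟩ := exists_escapeProbability_bound ρE hcpt
  have hcont : ContinuousOn (errorProbability P ρE V) (Metric.sphere 0 1) := by
    refine continuousOn_of_dominated (bound := fun _ => C)
      (fun ψ _ => (integrable_escapeProbability ρE hV hV1 ψ).aestronglyMeasurable)
      (fun ψ hψ => Eventually.of_forall fun ω => hC _ (hV1 ω) ψ hψ) (integrable_const _)
      (Eventually.of_forall fun ω => ?_)
    exact ((continuous_escapeProbability ρE).comp (Continuous.prodMk_right (V ω))).continuousOn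
  rw [worstCaseError, hsphere]
  exact (hcpt.image_of_continuousOn hcont).isGreatest_sSup
    ((NormedSpace.sphere_nonempty.2 zero_le_one).image _)

theorem worstCaseError_le [Nonempty S] {ρE : Matrix E E ℂ} {Δt T : ℝ} (hρ : ρE.PosSemidef)
    (htr : ρE.trace = 1) (hΔ : 0 < Δt) (hR : R.Irreducible) (hunif : γ.Uniform P)
    (hind : γ.IndependentBeyond P Δt) (hk : ∀ t, 0 ≤ t → ‖D.interaction t‖ ≤ k)
    {U : Ω → ℝ → Matrix (S × E) (S × E) ℂ}
    (hU : ∀ ω, IsPropagator (D.logicalHamiltonian (γ.propagator R ω)) (U ω)) (hT : 0 ≤ T) :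
    worstCaseError P ρE (fun ω => U ω T) ≤ 4 * T * Δt * k ^ 2 := by
  obtain ⟨ψ, hψ, hψe⟩ := (isGreatest_worstCaseError (P := P) ρE
    (stronglyMeasurable_logicalPropagator hU hk hT) (norm_logicalPropagator_le hU hk hT)).1
  rw [← hψe]
  have hQE : Commute (escapeObservable E ψ) ((1 : Matrix S S ℂ) ⊗ₖ D.HE) := by
    simp only [escapeObservable, Commute, SemiconjBy, ← Matrix.mul_kronecker_mul,
      Matrix.mul_one, Matrix.one_mul]
  simp only [errorProbability, escapeProbability_eq]
  exact hind.integral_re_le hunif hΔ (D.stronglyMeasurable_toggledInteraction R)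
    (D.norm_toggledInteraction_le R hk) ((norm_nonneg _).trans (hk 0 le_rfl))
    (D.isSelfAdjoint_toggledInteraction R) (D.sum_toggledInteraction hR)
    D.isSelfAdjoint_environment (norm_densityFunctional_le hρ htr hψ)
    (norm_escapeObservable_le hψ) hQE (densityFunctional_escapeObservable ρE hψ) hT
    (fun ω => (hU ω).isPropagatorOn_toggled hk hT)

end LogicalPropagator

/-! ### The main theorem. -/

theorem theorem1 :
    ∃ C δ : ℝ, 0 < C ∧ 0 < δ ∧
      ∀ (S E A G Ω : Type*)
        [Fintype S] [DecidableEq S] [Nonempty S] [Fintype E] [DecidableEq E] [Fintype A]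
        [Group G] [Fintype G] [MeasurableSpace G] [MeasurableSingletonClass G]
        [MeasurableSpace Ω] (P : Measure Ω) [IsProbabilityMeasure P]
        (D : OpenSystem S E A) (R : DecouplingGroup G S) (γ : BangBangControl Ω G)
        (ρE : Matrix E E ℂ) (Δt k : ℝ),
        ρE.PosSemidef → ρE.trace = 1 → 0 < Δt →
        R.Irreducible → γ.Uniform P → γ.IndependentBeyond P Δt →
        (∀ t : ℝ, 0 ≤ t → ‖D.interaction t‖ ≤ k) →
        (∀ ω, ∃ U, IsPropagator (D.logicalHamiltonian (γ.propagator R ω)) U) ∧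
        ∀ U : Ω → ℝ → Matrix (S × E) (S × E) ℂ,
          (∀ ω, IsPropagator (D.logicalHamiltonian (γ.propagator R ω)) (U ω)) →
          ∀ T : ℝ, 0 < T →
            (∀ ψ : EuclideanSpace ℂ S, Integrable (fun ω => escapeProbability ρE (U ω T) ψ) P) ∧
            IsGreatest
              (errorProbability P ρE (fun ω => U ω T) '' {ψ : EuclideanSpace ℂ S | ‖ψ‖ = 1})
              (worstCaseError P ρE (fun ω => U ω T)) ∧
            (4 * T * Δt * k ^ 2 < 1 →
              worstCaseError P ρE (fun ω => U ω T) ≤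
                4 * T * Δt * k ^ 2 * (1 + 8 * Δt * k + 4 * T * Δt * k ^ 2) /
                  (1 - 4 * T * Δt * k ^ 2) ^ 2) ∧
            (T * Δt * k ^ 2 ≤ δ →
              worstCaseError P ρE (fun ω => U ω T) ≤ C * (T * Δt * k ^ 2)) := by
  -- The bound `4TΔt k²` needs no smallness, so `C = 4` serves with any positive `δ`.
  refine ⟨4, 1, by norm_num, one_pos, ?_⟩
  intro S E A G Ω _ _ _ _ _ _ _ _ _ _ _ P _ D R γ ρE Δt k hρ htr hΔ hR hunif hind hk
  refine ⟨exists_isPropagator_logicalHamiltonian γ hk, fun U hU T hT => ?_⟩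
  have hUm := stronglyMeasurable_logicalPropagator hU hk hT.le
  have hU1 := norm_logicalPropagator_le hU hk hT.le
  have hle := worstCaseError_le hρ htr hΔ hR hunif hind hk hU hT.le
  refine ⟨integrable_escapeProbability ρE hUm hU1, isGreatest_worstCaseError ρE hUm hU1,
    fun hx => ?_, fun _ => hle.trans_eq (by ring)⟩
  have hk0 : 0 ≤ k := (norm_nonneg _).trans (hk 0 le_rfl)
  have hΔk : 0 ≤ Δt * k := mul_nonneg hΔ.le hk0
  have hx0 : 0 ≤ 4 * T * Δt * k ^ 2 := by positivity
  -- With `x = 4TΔt k²` in `[0, 1)`, the factor multiplying `x` is at least one: `(1 - x)² ≤ 1 ≤ 1 +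
  -- 8Δt k + x`.
  refine hle.trans ?_
  generalize 4 * T * Δt * k ^ 2 = x at hx hx0
  rw [le_div_iff₀ (by nlinarith)]
  refine mul_le_mul_of_nonneg_left ?_ hx0
  nlinarith
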